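/- Let $n\ge 2$ and let $(M,g)$ be a smooth $n$-dimensional Lorentzian manifold (Hausdorff, second countable, signature $(-,+,\dots,+)$) of constant curvature, i.e. its scalar curvature $R$ is constant and $$R_{jklm}=\frac{R}{n(n-1)}\,(g_{jl}g_{km}-g_{jm}g_{kl}),$$ with the sign convention in which $R_{jk}=\frac{R}{n}g_{jk}$. Let $\nabla$ be the Levi-Civita connection and $\square=\nabla^j\nabla_j$. A smooth symmetric tensor $\mathscr C_{jk}$ is called a Codazzi tensor if $\nabla_i\mathscr C_{jk}=\nabla_j\mathscr C_{ik}$. A smooth symmetric tensor $T_{kl}$, with trace $T=T^k{}_k$, is called an energy-momentum tensor for Cotton gravity on $(M,g)$ if $$\nabla_jR_{kl}-\nabla_kR_{jl}-\frac{g_{kl}\nabla_jR-g_{jl}\nabla_kR}{2(n-1)}=\nabla_jT_{kl}-\nabla_kT_{jl}-\frac{g_{kl}\nabla_jT-g_{jl}\nabla_kT}{n-1}.$$ (1) (Ferus) A smooth symmetric tensor $\mathscr C_{jk}$ on $M$ is a Codazzi tensor if and only if every point of $M$ has an open neighbourhood with a smooth function $\phi$ on it such that, there, $$\mathscr C_{jk}=\nabla_j\nabla_k\phi+\frac{R\,\phi}{n(n-1)}\,g_{jk}.$$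 If $M$ is simply connected, then $\mathscr C_{jk}$ is a Codazzi tensor if and only if this holds on all of $M$ for a single smooth function $\phi:M\to\mathbb R$. (2) A smooth symmetric tensor $T_{kl}$ on $M$ is an energy-momentum tensor for Cotton gravity on $(M,g)$ if and only if every point of $M$ has an open neighbourhood with a smooth function $\phi$ on it such that, there, $$T_{kl}=g_{kl}\Big[\square\phi+\frac{R\,\phi}{n}-\frac{(n-2)R}{2n}\Big]-\nabla_k\nabla_l\phi.$$ If $M$ is simply connected, then $T_{kl}$ is an energy-momentum tensor for Cotton gravity on $(M,g)$ if and only if this holds on all of $M$ for a single smooth function $\phi:M\to\mathbb R$. -/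

import Mathlib

open Set
open scoped Manifold ContDiff

namespace CottonGravity

noncomputable section

/-! ### Tensor calculus in a coordinate domain of `ℝⁿ`

Here `G y` is the matrix `g_{ij}(y)` of the components of the metric at the coordinate point `y`, and
`H y` is the matrix of the components of another covariant tensor of order two. -/

/-- The partial derivative `∂_i f` of a function of the coordinates. -/
def partialDeriv {n : ℕ} (i : Fin n) (f : EuclideanSpace ℝ (Fin n) → ℝ)
    (y : EuclideanSpace ℝ (Fin n)) : ℝ :=
  fderiv ℝ f y (EuclideanSpace.single i 1)

/-- Christoffel symbol
`Γ^k_{ij} = (1/2) g^{kl} (∂_i g_{jl} + ∂_j g_{il} - ∂_l g_{ij})` of the Levi-Civita connection. -/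
def christoffel {n : ℕ} (G : EuclideanSpace ℝ (Fin n) → Matrix (Fin n) (Fin n) ℝ)
    (k i j : Fin n) (y : EuclideanSpace ℝ (Fin n)) : ℝ :=
  (1 / 2) * ∑ l, (G y)⁻¹ k l *
    (partialDeriv i (fun z => G z j l) y + partialDeriv j (fun z => G z i l) y
      - partialDeriv l (fun z => G z i j) y)

/-- Curvature tensor `R^m_{ljk}`, defined by `R(∂_j, ∂_k) ∂_l = R^m_{ljk} ∂_m`, where
`R(X, Y) = ∇_X ∇_Y - ∇_Y ∇_X - ∇_{[X,Y]}`. -/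
def riemannUp {n : ℕ} (G : EuclideanSpace ℝ (Fin n) → Matrix (Fin n) (Fin n) ℝ)
    (m l j k : Fin n) (y : EuclideanSpace ℝ (Fin n)) : ℝ :=
  partialDeriv j (christoffel G m k l) y - partialDeriv k (christoffel G m j l) y
    + ∑ p, (christoffel G m j p y * christoffel G p k l y
      - christoffel G m k p y * christoffel G p j l y)

/-- Curvature tensor with all indices down, `R_{mljk} = g_{mp} R^p_{ljk}`. -/
def riemann {n : ℕ} (G : EuclideanSpace ℝ (Fin n) → Matrix (Fin n) (Fin n) ℝ)
    (m l j k : Fin n) (y : EuclideanSpace ℝ (Fin n)) : ℝ :=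
  ∑ p, G y m p * riemannUp G p l j k y

/-- Ricci tensor `R_{lk} = R^j_{ljk}`. -/
def ricci {n : ℕ} (G : EuclideanSpace ℝ (Fin n) → Matrix (Fin n) (Fin n) ℝ)
    (y : EuclideanSpace ℝ (Fin n)) : Matrix (Fin n) (Fin n) ℝ :=
  Matrix.of fun l k => ∑ j, riemannUp G j l j k y

/-- Metric trace `H^k_k = g^{kl} H_{kl}`. -/
def metricTrace {n : ℕ} (G H : EuclideanSpace ℝ (Fin n) → Matrix (Fin n) (Fin n) ℝ)
    (y : EuclideanSpace ℝ (Fin n)) : ℝ :=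
  ∑ k, ∑ l, (G y)⁻¹ k l * H y k l

/-- Scalar curvature `R = g^{kl} R_{kl}`. -/
def scalarCurv {n : ℕ} (G : EuclideanSpace ℝ (Fin n) → Matrix (Fin n) (Fin n) ℝ)
    (y : EuclideanSpace ℝ (Fin n)) : ℝ :=
  metricTrace G (ricci G) y

/-- Covariant derivative
`∇_i H_{jk} = ∂_i H_{jk} - Γ^p_{ij} H_{pk} - Γ^p_{ik} H_{jp}`. -/
def covDeriv {n : ℕ} (G H : EuclideanSpace ℝ (Fin n) → Matrix (Fin n) (Fin n) ℝ)
    (i j k : Fin n) (y : EuclideanSpace ℝ (Fin n)) : ℝ :=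
  partialDeriv i (fun z => H z j k) y
    - ∑ p, (christoffel G p i j y * H y p k + christoffel G p i k y * H y j p)

/-- Hessian `∇_i ∇_j f = ∂_i ∂_j f - Γ^p_{ij} ∂_p f`. -/
def hessian {n : ℕ} (G : EuclideanSpace ℝ (Fin n) → Matrix (Fin n) (Fin n) ℝ)
    (f : EuclideanSpace ℝ (Fin n) → ℝ) (y : EuclideanSpace ℝ (Fin n)) :
    Matrix (Fin n) (Fin n) ℝ :=
  Matrix.of fun i j => partialDeriv i (partialDeriv j f) y
    - ∑ p, christoffel G p i j y * partialDeriv p f y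

/-- D'Alembertian `□f = ∇_j ∇^j f = g^{jk} ∇_j ∇_k f`. -/
def dAlembertian {n : ℕ} (G : EuclideanSpace ℝ (Fin n) → Matrix (Fin n) (Fin n) ℝ)
    (f : EuclideanSpace ℝ (Fin n) → ℝ) (y : EuclideanSpace ℝ (Fin n)) : ℝ :=
  metricTrace G (hessian G f) y

/-- Cotton tensor
`C_{jkl} = ∇_j R_{kl} - ∇_k R_{jl} - (g_{kl} ∇_j R - g_{jl} ∇_k R) / (2(n-1))`. -/
def cotton {n : ℕ} (G : EuclideanSpace ℝ (Fin n) → Matrix (Fin n) (Fin n) ℝ)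
    (j k l : Fin n) (y : EuclideanSpace ℝ (Fin n)) : ℝ :=
  covDeriv G (ricci G) j k l y - covDeriv G (ricci G) k j l y
    - (G y k l * partialDeriv j (scalarCurv G) y - G y j l * partialDeriv k (scalarCurv G) y)
      / (2 * ((n : ℝ) - 1))

/-- The source side of the Cotton gravity equation,
`∇_j T_{kl} - ∇_k T_{jl} - (g_{kl} ∇_j T - g_{jl} ∇_k T) / (n-1)`, with `T = T^k_k`. -/
def cottonSource {n : ℕ} (G H : EuclideanSpace ℝ (Fin n) → Matrix (Fin n) (Fin n) ℝ)
    (j k l : Fin n) (y : EuclideanSpace ℝ (Fin n)) : ℝ :=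
  covDeriv G H j k l y - covDeriv G H k j l y
    - (G y k l * partialDeriv j (metricTrace G H) y
        - G y j l * partialDeriv k (metricTrace G H) y) / ((n : ℝ) - 1)

/-! ### Tensor fields on a manifold -/

/-- Smooth symmetric covariant tensor fields of order two on an `n`-dimensional manifold. -/
structure SymTensorField (n : ℕ) (M : Type*) [TopologicalSpace M]
    [ChartedSpace (EuclideanSpace ℝ (Fin n)) M] [IsManifold (𝓡 n) ∞ M] where
  /-- The bilinear form on each tangent space. -/
  val : ∀ x : M, TangentSpace (𝓡 n) x →L[ℝ] TangentSpace (𝓡 n) x →L[ℝ] ℝ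
  symm : ∀ (x : M) (v w : TangentSpace (𝓡 n) x), val x v w = val x w v
  contMDiff : ContMDiff (𝓡 n)
    ((𝓡 n).prod 𝓘(ℝ, EuclideanSpace ℝ (Fin n) →L[ℝ] EuclideanSpace ℝ (Fin n) →L[ℝ] ℝ)) ∞
    (fun x => Bundle.TotalSpace.mk'
      (EuclideanSpace ℝ (Fin n) →L[ℝ] EuclideanSpace ℝ (Fin n) →L[ℝ] ℝ)
      (E := fun x : M => TangentSpace (𝓡 n) x →L[ℝ] TangentSpace (𝓡 n) x →L[ℝ] ℝ) x (val x))

/-- Lorentzian metrics, of signature `(-,+,…,+)`: every tangent space has a basis that is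
orthonormal with one timelike vector. -/
structure LorentzMetric (n : ℕ) (M : Type*) [TopologicalSpace M]
    [ChartedSpace (EuclideanSpace ℝ (Fin n)) M] [IsManifold (𝓡 n) ∞ M]
    extends SymTensorField n M where
  lorentzian : ∀ x : M, ∃ b : Module.Basis (Fin n) ℝ (TangentSpace (𝓡 n) x), ∀ i j : Fin n,
    val x (b i) (b j) = if i = j then (if (i : ℕ) = 0 then -1 else 1) else 0

variable {n : ℕ} {M : Type*} [TopologicalSpace M] [ChartedSpace (EuclideanSpace ℝ (Fin n)) M]

/-- The coordinate vector `∂_i` of the chart `e`, at the point with coordinates `y`. -/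
def coordVec (e : OpenPartialHomeomorph M (EuclideanSpace ℝ (Fin n))) (i : Fin n)
    (y : EuclideanSpace ℝ (Fin n)) : TangentSpace (𝓡 n) (e.symm y) :=
  mfderiv 𝓘(ℝ, EuclideanSpace ℝ (Fin n)) (𝓡 n) e.symm y (EuclideanSpace.single i (1 : ℝ))

variable [IsManifold (𝓡 n) ∞ M]

/-- The components `h_{ij} = h(∂_i, ∂_j)` of a tensor field in the chart `e`, as functions of the
coordinates. -/
def SymTensorField.comp (h : SymTensorField n M)
    (e : OpenPartialHomeomorph M (EuclideanSpace ℝ (Fin n)))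
    (y : EuclideanSpace ℝ (Fin n)) : Matrix (Fin n) (Fin n) ℝ :=
  Matrix.of fun i j => h.val (e.symm y) (coordVec e i y) (coordVec e j y)

/-- The metric has constant curvature, with scalar curvature the constant `R`:
`R_{jklm} = R / (n(n-1)) (g_{jl} g_{km} - g_{jm} g_{kl})`. -/
def HasConstantCurvature (g : LorentzMetric n M) (R : ℝ) : Prop :=
  ∀ e ∈ atlas (EuclideanSpace ℝ (Fin n)) M, ∀ y ∈ e.target,
    scalarCurv (g.comp e) y = R ∧
    ∀ j k l m : Fin n, riemann (g.comp e) j k l m y =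
      R / ((n : ℝ) * ((n : ℝ) - 1)) *
        (g.comp e y j l * g.comp e y k m - g.comp e y j m * g.comp e y k l)

/-- Codazzi tensors: `∇_i C_{jk} = ∇_j C_{ik}`. -/
def IsCodazzi (g : LorentzMetric n M) (C : SymTensorField n M) : Prop :=
  ∀ e ∈ atlas (EuclideanSpace ℝ (Fin n)) M, ∀ y ∈ e.target, ∀ i j k : Fin n,
    covDeriv (g.comp e) (C.comp e) i j k y = covDeriv (g.comp e) (C.comp e) j i k y

/-- `T` is an energy-momentum tensor with which the metric `g` solves the Cotton gravity equation
`C_{jkl} = ∇_j T_{kl} - ∇_k T_{jl} - (g_{kl} ∇_j T - g_{jl} ∇_k T) / (n-1)`. -/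
def SolvesCottonGravity (g : LorentzMetric n M) (T : SymTensorField n M) : Prop :=
  ∀ e ∈ atlas (EuclideanSpace ℝ (Fin n)) M, ∀ y ∈ e.target, ∀ j k l : Fin n,
    cotton (g.comp e) j k l y = cottonSource (g.comp e) (T.comp e) j k l y

/-- `C_{jk} = ∇_j ∇_k φ + R φ g_{jk} / (n(n-1))` at all points of `U`, in all charts. -/
def HasFerusFormOn (g : LorentzMetric n M) (R : ℝ) (C : SymTensorField n M) (φ : M → ℝ)
    (U : Set M) : Prop :=
  ∀ e ∈ atlas (EuclideanSpace ℝ (Fin n)) M, ∀ y ∈ e.target, e.symm y ∈ U → ∀ j k : Fin n,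
    C.comp e y j k = hessian (g.comp e) (φ ∘ e.symm) y j k
      + R * φ (e.symm y) / ((n : ℝ) * ((n : ℝ) - 1)) * g.comp e y j k

/-- `T_{kl} = g_{kl} [□φ + R φ / n - (n-2) R / (2n)] - ∇_k ∇_l φ` at all points of `U`, in all
charts. -/
def HasEnergyMomentumFormOn (g : LorentzMetric n M) (R : ℝ) (T : SymTensorField n M) (φ : M → ℝ)
    (U : Set M) : Prop :=
  ∀ e ∈ atlas (EuclideanSpace ℝ (Fin n)) M, ∀ y ∈ e.target, e.symm y ∈ U → ∀ k l : Fin n,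
    T.comp e y k l = g.comp e y k l *
        (dAlembertian (g.comp e) (φ ∘ e.symm) y + R * φ (e.symm y) / n
          - ((n : ℝ) - 2) * R / (2 * n))
      - hessian (g.comp e) (φ ∘ e.symm) y k l

end

end CottonGravity

/-! Write κ = R/(n(n-1)). In a chart, C = ∇∇φ + κφg prescribes the second derivatives of φ in terms
of φ, its gradient and C. It is therefore a first-order total differential equation Du(y)h = A(y)h
u(y) for the jet u = (φ, ∂φ). A further coordinate, constantly 1, multiplies C and turns this affine
system into a linear one (`ferusSystem`). In its curvature, metric compatibility cancels the terms
in φ and constant curvature cancels those in ∂φ. What remains is ∇_i C_jk - ∇_j C_ik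
(`curvature_prescribedHessian`). So the Codazzi equation is exactly the integrability condition: it
is necessary because third derivatives of φ commute (`codazzi_of_form`), and sufficient by the
linear Frobenius theorem (`exists_solution_of_curvature_eq_zero`), proved by integrating along
segments from a base point.

For the global statement, the solutions on a small ball are parametrized by their jet at the centre,
and every germ of a solution at a point of the ball extends to exactly one of them
(`exists_local_family`). This makes sense on the manifold because the Hessian is a tensor
(`hessian_transformed`). The germs of solutions thus form a covering space of M with discrete fibre
ℝ × ℝⁿ. Over a simply connected M the identity lifts to a section, which is a global φ
(`exists_global_of_germs`).

For Cotton gravity, the Cotton tensor of a space of constant curvature vanishes. Since ∇g = 0, the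
equation for T then says that (tr T) g/(n-1) - T is a Codazzi tensor (`solvesCottonGravity_iff`). If
this tensor is ∇∇f + κfg, its trace determines tr T, and T = g(□f + Rf/n) - ∇∇f. The constant
-(n-2)R/(2n) in the stated formula only records the shift f = φ - (n-2)/2
(`hasEnergyMomentumFormOn_iff`). -/

namespace CottonGravity

/-! ### Linear total differential equations -/

section TotalDifferentialEquation

open Metric Filter Topology

set_option maxSynthPendingDepth 3

variable {E V : Type*} [NormedAddCommGroup E] [NormedSpace ℝ E]
  [NormedAddCommGroup V] [NormedSpace ℝ V]

/-- Grönwall's inequality on the unit interval with rate 1, where the exponential factor is at most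
e < 3. The norm estimates in the existence proof are all brought to this shape. -/
theorem norm_le_of_norm_deriv_le_add {f f' : ℝ → V} {δ ε : ℝ} (hδ : 0 ≤ δ) (hε : 0 ≤ ε)
    (hf : ∀ t ∈ Icc (0 : ℝ) 1, HasDerivWithinAt f (f' t) (Icc 0 1) t) (h0 : ‖f 0‖ ≤ δ)
    (bound : ∀ t ∈ Icc (0 : ℝ) 1, ‖f' t‖ ≤ ‖f t‖ + ε) :
    ∀ t ∈ Icc (0 : ℝ) 1, ‖f t‖ ≤ 3 * (δ + ε) := by
  intro t ht
  have h := norm_le_gronwallBound_of_norm_deriv_right_le (K := 1) (ε := ε)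
    (fun t ht => (hf t ht).continuousWithinAt)
    (fun x hx => (hf x (Ico_subset_Icc_self hx)).mono_of_mem_nhdsWithin
      (Icc_mem_nhdsGE_of_mem hx)) h0
    (fun x hx => by simpa using bound x (Ico_subset_Icc_self hx)) t ht
  refine h.trans ?_
  rw [gronwallBound_of_K_ne_0 one_ne_zero]
  have h1 : Real.exp (1 * (t - 0)) ≤ 3 := by
    have := Real.exp_one_lt_d9
    have : Real.exp (1 * (t - 0)) ≤ Real.exp 1 := Real.exp_le_exp.2 (by linarith [ht.2])
    linarith
  have h2 : (0 : ℝ) < Real.exp (1 * (t - 0)) := Real.exp_pos _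
  simp only [div_one]
  nlinarith

variable {A : E → E →L[ℝ] V →L[ℝ] V} {U : Set E} {K : ℝ}

/-- Restricted to a segment, the total differential equation is a linear ODE. The smallness of `U`
relative to `K` lets Picard–Lindelöf reach time 1 in a single step. -/
theorem exists_solution_along_segment [CompleteSpace V] (hU : Convex ℝ U)
    (hA : ∀ y ∈ U, ‖A y‖ ≤ K) (hc : ContinuousOn A U)
    (hd : ∀ y ∈ U, ∀ z ∈ U, K * ‖z - y‖ ≤ 1 / 2)
    {y₀ y : E} (hy₀ : y₀ ∈ U) (hy : y ∈ U) (w : V) :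
    ∃ γ : ℝ → V, γ 0 = w ∧ ∀ t ∈ Icc (0 : ℝ) 1,
      HasDerivWithinAt γ (A (y₀ + t • (y - y₀)) (y - y₀) (γ t)) (Icc 0 1) t := by
  have hmem : ∀ t ∈ Icc (0 : ℝ) 1, y₀ + t • (y - y₀) ∈ U := fun t ht =>
    hU.add_smul_sub_mem hy₀ hy ht
  have hb : ∀ t ∈ Icc (0 : ℝ) 1, ‖A (y₀ + t • (y - y₀)) (y - y₀)‖ ≤ 1 / 2 := fun t ht =>
    ((A _).le_opNorm _).trans <| le_trans
      (mul_le_mul_of_nonneg_right (hA _ (hmem t ht)) (norm_nonneg _)) (hd _ hy₀ _ hy)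
  -- In the ball of radius ‖w‖ about w vectors have norm at most 2‖w‖, so the speed is at most
  -- (1/2)·2‖w‖ = ‖w‖ and the curve stays in that ball up to time 1.
  have hP : IsPicardLindelof (fun t u => A (y₀ + t • (y - y₀)) (y - y₀) u)
      (⟨0, by simp⟩ : Icc (0 : ℝ) 1) w ‖w‖₊ 0 ‖w‖₊ (1 / 2) := by
    refine ⟨fun t ht => ?_, fun x _ => ?_, fun t ht x hx => ?_, ?_⟩
    · refine ((A (y₀ + t • (y - y₀)) (y - y₀)).lipschitz.weaken ?_).lipschitzOnWith
      exact_mod_cast hb t ht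
    · have h1 : ContinuousOn (fun t : ℝ => A (y₀ + t • (y - y₀))) (Icc 0 1) :=
        hc.comp (by fun_prop) hmem
      exact (h1.clm_apply continuousOn_const).clm_apply continuousOn_const
    · refine ((A (y₀ + t • (y - y₀)) (y - y₀)).le_opNorm x).trans ?_
      have hx' : ‖x‖ ≤ 2 * ‖w‖ := by
        have := norm_sub_norm_le x w
        rw [mem_closedBall, dist_eq_norm] at hx
        simp only [coe_nnnorm] at hx
        linarith
      have := hb t ht
      simp only [coe_nnnorm]
      nlinarith [norm_nonneg x, norm_nonneg (A (y₀ + t • (y - y₀)) (y - y₀))]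
    · simp
  obtain ⟨γ, h0, h⟩ := hP.exists_eq_forall_mem_Icc_hasDerivWithinAt₀
  exact ⟨γ, h0, h⟩

/-- A linear total differential equation `Du(y)h = A(y)h u(y)` of vanishing curvature can be solved
with any initial value at any point of a small convex set. -/
theorem exists_solution_of_curvature_eq_zero [CompleteSpace V]
    {A' : E → E →L[ℝ] E →L[ℝ] V →L[ℝ] V} (hK : 0 ≤ K) (hU : Convex ℝ U) (hUo : IsOpen U)
    (hA : ∀ y ∈ U, ‖A y‖ ≤ K) (hA' : ∀ y ∈ U, ‖A' y‖ ≤ K)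
    (hder : ∀ y ∈ U, HasFDerivAt A (A' y) y)
    (hA1 : ∀ y ∈ U, ∀ z ∈ U, ‖A z - A y‖ ≤ K * ‖z - y‖)
    (hA2 : ∀ y ∈ U, ∀ z ∈ U, ‖A z - A y - A' y (z - y)‖ ≤ K * ‖z - y‖ ^ 2)
    (hd : ∀ y ∈ U, ∀ z ∈ U, K * ‖z - y‖ ≤ 1 / 2) (hd1 : ∀ y ∈ U, ∀ z ∈ U, ‖z - y‖ ≤ 1)
    (hcurv : ∀ y ∈ U, ∀ h k u, A' y h k u + A y k (A y h u) = A' y k h u + A y h (A y k u))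
    {y₀ : E} (hy₀ : y₀ ∈ U) (w : V) :
    ∃ u : E → V, u y₀ = w ∧ ∀ y ∈ U, HasFDerivAt u ((A y).flip (u y)) y := by
  have hc : ContinuousOn A U := fun y hy => (hder y hy).continuousAt.continuousWithinAt
  -- `γ y` transports w along the segment from y₀ to y; the solution will be its end value `γ y 1`.
  choose! γ hγ0 hγ using fun y (hy : y ∈ U) =>
    exists_solution_along_segment hU hA hc hd hy₀ hy w
  have hmem : ∀ y ∈ U, ∀ t ∈ Icc (0 : ℝ) 1, y₀ + t • (y - y₀) ∈ U := fun y hy t ht =>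
    hU.add_smul_sub_mem hy₀ hy ht
  have hb : ∀ y ∈ U, ∀ t ∈ Icc (0 : ℝ) 1, ∀ x : V,
      ‖A (y₀ + t • (y - y₀)) (y - y₀) x‖ ≤ ‖x‖ := by
    intro y hy t ht x
    have h1 : ‖A (y₀ + t • (y - y₀)) (y - y₀)‖ ≤ 1 / 2 := ((A _).le_opNorm _).trans <| le_trans
      (mul_le_mul_of_nonneg_right (hA _ (hmem y hy t ht)) (norm_nonneg _)) (hd _ hy₀ _ hy)
    refine ((A _ _).le_opNorm _).trans ?_
    nlinarith [norm_nonneg x]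
  have hM : ∀ y ∈ U, ∀ t ∈ Icc (0 : ℝ) 1, ‖γ y t‖ ≤ 3 * ‖w‖ := by
    intro y hy
    have := norm_le_of_norm_deriv_le_add (norm_nonneg w) le_rfl (hγ y hy) (by rw [hγ0 y hy])
      (fun t ht => by simpa using hb y hy t ht (γ y t))
    simpa using this
  set M := 3 * ‖w‖ with hMdef
  have hM0 : 0 ≤ M := by positivity
  -- dependence on the end point of the segment
  have hdiff : ∀ y ∈ U, ∀ z ∈ U, ∀ t ∈ Icc (0 : ℝ) 1,
      ‖γ z t - γ y t‖ ≤ 6 * K * M * ‖z - y‖ := by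
    intro y hy z hz
    have := norm_le_of_norm_deriv_le_add (f := fun t => γ z t - γ y t) (δ := 0)
      (ε := 2 * K * M * ‖z - y‖) le_rfl (by positivity)
      (fun t ht => (hγ z hz t ht).sub (hγ y hy t ht))
      (by simp [hγ0 z hz, hγ0 y hy]) ?_
    · intro t ht
      have := this t ht
      simp only [zero_add] at this
      linarith
    intro t ht
    set p := y₀ + t • (y - y₀)
    set q := y₀ + t • (z - y₀)
    have hqp : q - p = t • (z - y) := by simp only [p, q, ← smul_sub, add_sub_add_left_eq_sub]; simp
    have hqp' : ‖q - p‖ ≤ ‖z - y‖ := by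
      rw [hqp, norm_smul, Real.norm_of_nonneg ht.1]
      nlinarith [norm_nonneg (z - y), ht.2]
    have e1 : A q (z - y₀) (γ z t) - A p (y - y₀) (γ y t)
        = A p (y - y₀) (γ z t - γ y t) + (A q - A p) (y - y₀) (γ z t) + A q (z - y) (γ z t) := by
      have : z - y₀ = (y - y₀) + (z - y) := by abel
      rw [this]
      simp only [map_add, map_sub, _root_.add_apply, _root_.sub_apply]
      abel
    rw [e1]
    have n1 := hb y hy t ht (γ z t - γ y t)
    have n2 : ‖(A q - A p) (y - y₀) (γ z t)‖ ≤ K * ‖z - y‖ * 1 * M := by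
      refine ((A q - A p).le_opNorm₂ _ _).trans ?_
      gcongr
      · exact (hA1 _ (hmem y hy t ht) _ (hmem z hz t ht)).trans (by gcongr)
      · exact hd1 _ hy₀ _ hy
      · exact hM z hz t ht
    have n3 : ‖A q (z - y) (γ z t)‖ ≤ K * ‖z - y‖ * M := by
      refine ((A q).le_opNorm₂ _ _).trans ?_
      gcongr
      · exact hA _ (hmem z hz t ht)
      · exact hM z hz t ht
    refine (norm_add₃_le).trans ?_
    linarith
  refine ⟨fun y => γ y 1, ?_, fun y hy => ?_⟩
  · -- the constant segment
    have h0 := norm_le_of_norm_deriv_le_add (f := fun t => γ y₀ t - w) (δ := 0) (ε := 0) le_rfl le_rfl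
      (fun t ht => (hγ y₀ hy₀ t ht).sub_const w) (by simp [hγ0 y₀ hy₀]) (by simp) 1 (by simp)
    simpa [sub_eq_zero] using h0
  -- The 3 is Grönwall's factor; 2KM collects the errors `n2` and `n4` below, and 12K²M collects
  -- `n3` and `n5`.
  set C := 3 * (2 * K * M + 12 * K ^ 2 * M)
  -- Grönwall is applied to γ_z(t) - γ_y(t) - t A(z - y)γ_y(t), with A taken at the point y₀ + t(y -
  -- y₀). It vanishes at t = 0 and equals the first-order remainder at t = 1, so no
  -- differentiability of the flow in its parameter is needed.
  have key : ∀ z ∈ U, ‖γ z 1 - γ y 1 - A y (z - y) (γ y 1)‖ ≤ C * ‖z - y‖ ^ 2 := by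
    intro z hz
    have hp' : ∀ t ∈ Icc (0 : ℝ) 1, HasDerivWithinAt (fun t : ℝ => A (y₀ + t • (y - y₀)))
        (A' (y₀ + t • (y - y₀)) (y - y₀)) (Icc 0 1) t := by
      intro t ht
      have h1 : HasDerivWithinAt (fun t : ℝ => y₀ + t • (y - y₀)) (y - y₀) (Icc 0 1) t := by
        simpa using! (((hasDerivAt_id t).smul_const (y - y₀)).const_add y₀).hasDerivWithinAt
      exact (hder _ (hmem y hy t ht)).comp_hasDerivWithinAt t h1
    have hD : ∀ t ∈ Icc (0 : ℝ) 1, HasDerivWithinAt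
        (fun t : ℝ => γ z t - γ y t - t • A (y₀ + t • (y - y₀)) (z - y) (γ y t))
        (A (y₀ + t • (z - y₀)) (z - y₀) (γ z t) - A (y₀ + t • (y - y₀)) (y - y₀) (γ y t)
          - (t • (A' (y₀ + t • (y - y₀)) (y - y₀) (z - y) (γ y t)
            + A (y₀ + t • (y - y₀)) (z - y) (A (y₀ + t • (y - y₀)) (y - y₀) (γ y t)))
            + A (y₀ + t • (y - y₀)) (z - y) (γ y t))) (Icc 0 1) t := by
      intro t ht
      have h1 : HasDerivWithinAt (fun t : ℝ => A (y₀ + t • (y - y₀)) (z - y))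
          (A' (y₀ + t • (y - y₀)) (y - y₀) (z - y)) (Icc 0 1) t := by
        simpa using (hp' t ht).clm_apply (hasDerivWithinAt_const t _ (z - y))
      have h2 := h1.clm_apply (hγ y hy t ht)
      have h3 := (hasDerivWithinAt_id t (Icc 0 1)).smul h2
      simpa using! ((hγ z hz t ht).sub (hγ y hy t ht)).sub h3
    have := norm_le_of_norm_deriv_le_add (δ := 0)
      (ε := (2 * K * M + 12 * K ^ 2 * M) * ‖z - y‖ ^ 2) le_rfl (by positivity) hD
      (by simp [hγ0 z hz, hγ0 y hy]) ?_ 1 (by simp)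
    · simp only [one_smul, zero_add, add_sub_cancel] at this
      simp only [C]
      linarith
    intro t ht
    set p := y₀ + t • (y - y₀)
    set q := y₀ + t • (z - y₀)
    have hpU : p ∈ U := hmem y hy t ht
    have hqU : q ∈ U := hmem z hz t ht
    have hqp : q - p = t • (z - y) := by simp only [p, q, ← smul_sub, add_sub_add_left_eq_sub]; simp
    have hqp' : ‖q - p‖ ≤ ‖z - y‖ := by
      rw [hqp, norm_smul, Real.norm_of_nonneg ht.1]
      nlinarith [norm_nonneg (z - y), ht.2]
    have e1 : A q (z - y₀) (γ z t) - A p (y - y₀) (γ y t)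
          - (t • (A' p (y - y₀) (z - y) (γ y t) + A p (z - y) (A p (y - y₀) (γ y t)))
            + A p (z - y) (γ y t))
        = A p (y - y₀) (γ z t - γ y t - t • A p (z - y) (γ y t))
          + (A q - A p - A' p (q - p)) (y - y₀) (γ z t)
          + t • A' p (z - y) (y - y₀) (γ z t - γ y t)
          + (A q - A p) (z - y) (γ z t) + A p (z - y) (γ z t - γ y t) := by
      -- Vanishing curvature enters here: it exchanges the directions y - y₀ and z - y. The terms of
      -- first order in z - y then combine into A p (y - y₀) acting on the remainder and the Taylor
      -- remainder of A, and the rest is quadratic.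
      rw [hcurv p hpU, hqp]
      have : z - y₀ = (y - y₀) + (z - y) := by abel
      rw [this]
      generalize z - y = h
      generalize y - y₀ = v
      simp only [map_add, map_sub, map_smul, _root_.add_apply,
        _root_.sub_apply, _root_.smul_apply, smul_add, smul_sub]
      abel
    rw [e1]
    have n1 := hb y hy t ht (γ z t - γ y t - t • A p (z - y) (γ y t))
    have hv1 : ‖y - y₀‖ ≤ 1 := hd1 _ hy₀ _ hy
    have n2 : ‖(A q - A p - A' p (q - p)) (y - y₀) (γ z t)‖ ≤ K * ‖z - y‖ ^ 2 * 1 * M := by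
      refine ((A q - A p - A' p (q - p)).le_opNorm₂ _ _).trans ?_
      gcongr
      · exact (hA2 _ hpU _ hqU).trans (by gcongr)
      · exact hM z hz t ht
    have n3 : ‖t • A' p (z - y) (y - y₀) (γ z t - γ y t)‖
        ≤ K * ‖z - y‖ * 1 * (6 * K * M * ‖z - y‖) := by
      rw [norm_smul, Real.norm_of_nonneg ht.1]
      have : ‖A' p (z - y) (y - y₀) (γ z t - γ y t)‖
          ≤ K * ‖z - y‖ * 1 * (6 * K * M * ‖z - y‖) := by
        refine ((A' p (z - y)).le_opNorm₂ _ _).trans ?_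
        gcongr
        · exact ((A' p).le_opNorm _).trans (by gcongr; exact hA' p hpU)
        · exact hdiff y hy z hz t ht
      nlinarith [norm_nonneg (A' p (z - y) (y - y₀) (γ z t - γ y t)), ht.1, ht.2]
    have n4 : ‖(A q - A p) (z - y) (γ z t)‖ ≤ K * ‖z - y‖ * ‖z - y‖ * M := by
      refine ((A q - A p).le_opNorm₂ _ _).trans ?_
      gcongr
      · exact (hA1 _ hpU _ hqU).trans (by gcongr)
      · exact hM z hz t ht
    have n5 : ‖A p (z - y) (γ z t - γ y t)‖ ≤ K * ‖z - y‖ * (6 * K * M * ‖z - y‖) := by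
      refine ((A p).le_opNorm₂ _ _).trans ?_
      gcongr
      · exact hA _ hpU
      · exact hdiff y hy z hz t ht
    refine (norm_add_le _ _).trans ?_
    refine (add_le_add_left (norm_add_le _ _) _).trans ?_
    refine (add_le_add_left (add_le_add_left norm_add₃_le _) _).trans ?_
    linarith
  rw [hasFDerivAt_iff_isLittleO]
  have hO : (fun z => γ z 1 - γ y 1 - ((A y).flip (γ y 1)) (z - y)) =O[𝓝 y]
      fun z => ‖z - y‖ ^ 2 := by
    refine Asymptotics.IsBigO.of_bound C ?_
    filter_upwards [hUo.mem_nhds hy] with z hz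
    simpa using key z hz
  refine hO.trans_isLittleO ?_
  exact Asymptotics.isLittleO_pow_sub_sub y one_lt_two

/-- Two solutions of a linear total differential equation on a convex set agree if they agree at
one point. -/
theorem solution_unique (hU : Convex ℝ U) (hc : ContinuousOn A U) {u₁ u₂ : E → V}
    (h₁ : ∀ y ∈ U, HasFDerivAt u₁ ((A y).flip (u₁ y)) y)
    (h₂ : ∀ y ∈ U, HasFDerivAt u₂ ((A y).flip (u₂ y)) y) {y₀ : E} (hy₀ : y₀ ∈ U)
    (h0 : u₁ y₀ = u₂ y₀) : EqOn u₁ u₂ U := by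
  intro y hy
  have hmem : ∀ t ∈ Icc (0 : ℝ) 1, y₀ + t • (y - y₀) ∈ U := fun t ht =>
    hU.add_smul_sub_mem hy₀ hy ht
  have hcA : ContinuousOn (fun t : ℝ => A (y₀ + t • (y - y₀)) (y - y₀)) (Icc 0 1) :=
    (hc.comp (by fun_prop) hmem).clm_apply continuousOn_const
  obtain ⟨B, hB⟩ := isCompact_Icc.exists_bound_of_continuousOn hcA
  have hu : ∀ t ∈ Icc (0 : ℝ) 1, HasDerivAt
      (fun t : ℝ => u₁ (y₀ + t • (y - y₀)) - u₂ (y₀ + t • (y - y₀)))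
      (A (y₀ + t • (y - y₀)) (y - y₀) (u₁ (y₀ + t • (y - y₀)) - u₂ (y₀ + t • (y - y₀)))) t := by
    intro t ht
    have hl : HasDerivAt (fun t : ℝ => y₀ + t • (y - y₀)) (y - y₀) t := by
      simpa using! ((hasDerivAt_id t).smul_const (y - y₀)).const_add y₀
    rw [map_sub]
    exact ((h₁ _ (hmem t ht)).comp_hasDerivAt t hl).sub
      ((h₂ _ (hmem t ht)).comp_hasDerivAt t hl)
  have := eq_zero_of_abs_deriv_le_mul_abs_self_of_eq_zero_right (K := B)
    (fun t ht => (hu t ht).continuousAt.continuousWithinAt)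
    (fun t ht => (hu t (Ico_subset_Icc_self ht)).hasDerivWithinAt) (by simp [h0])
    (fun t ht => ((A _ _).le_opNorm _).trans
      (mul_le_mul_of_nonneg_right (hB t (Ico_subset_Icc_self ht)) (norm_nonneg _))) 1 (by simp)
  simpa [sub_eq_zero] using this

/-- The solutions of a smooth linear total differential equation are smooth. -/
theorem contDiffOn_solution (hUo : IsOpen U) (hA : ContDiffOn ℝ ∞ A U) {u : E → V}
    (hu : ∀ y ∈ U, HasFDerivAt u ((A y).flip (u y)) y) : ContDiffOn ℝ ∞ u U := by
  refine contDiffOn_infty.2 fun k => ?_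
  -- Bootstrapping: the derivative of u is `(A y).flip (u y)`, which is as regular as u itself.
  induction k with
  | zero =>
    exact contDiffOn_zero.2 fun y hy => (hu y hy).continuousAt.continuousWithinAt
  | succ k ih =>
    push_cast
    rw [contDiffOn_succ_iff_fderiv_of_isOpen hUo]
    refine ⟨fun y hy => (hu y hy).differentiableAt.differentiableWithinAt, by simp, ?_⟩
    have h1 : ContDiffOn ℝ k (fun y => (A y).flip (u y)) U :=
      ((ContinuousLinearMap.flipₗᵢ ℝ E V V).toContinuousLinearEquiv.contDiff.comp_contDiffOn
        (hA.of_le (by exact_mod_cast le_top))).clm_apply ih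
    exact h1.congr fun y hy => (hu y hy).fderiv

/-- On a small ball around each point of its domain, a smooth linear total differential equation of
vanishing curvature can be solved with any initial value at any point. -/
theorem exists_ball_forall_exists_solution [CompleteSpace V] {Ω : Set E} (hΩ : IsOpen Ω)
    (hA : ContDiffOn ℝ ∞ A Ω)
    (hcurv : ∀ y ∈ Ω, ∀ h k u, fderiv ℝ A y h k u + A y k (A y h u)
      = fderiv ℝ A y k h u + A y h (A y k u)) {p : E} (hp : p ∈ Ω) :
    ∃ r > 0, ball p r ⊆ Ω ∧ ∀ y₀ ∈ ball p r, ∀ w : V,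
      ∃ u : E → V, u y₀ = w ∧ ∀ y ∈ ball p r, HasFDerivAt u ((A y).flip (u y)) y := by
  have hAp : ContDiffAt ℝ ∞ A p := hA.contDiffAt (hΩ.mem_nhds hp)
  have hA'p : ContDiffAt ℝ 1 (fderiv ℝ A) p := hAp.fderiv_right (by norm_cast)
  obtain ⟨K₀, S, hS, hlip⟩ := hA'p.exists_lipschitzOnWith
  -- A single constant dominates the Lipschitz constant of the derivative of A and, near p, the
  -- norms of A and its derivative. It is at least 1, so K‖z - y‖ ≤ 1/2 also gives ‖z - y‖ ≤ 1.
  set K : ℝ := max K₀ (max (‖A p‖ + 1) (‖fderiv ℝ A p‖ + 1)) with hKdef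
  have hK0 : (K₀ : ℝ) ≤ K := le_max_left _ _
  have hK1 : ‖A p‖ + 1 ≤ K := (le_max_left _ _).trans (le_max_right _ _)
  have hK2 : ‖fderiv ℝ A p‖ + 1 ≤ K := (le_max_right _ _).trans (le_max_right _ _)
  have hKone : 1 ≤ K := by linarith [norm_nonneg (A p)]
  have e1 : ∀ᶠ y in 𝓝 p, ‖A y‖ < K :=
    hAp.continuousAt.norm.eventually_lt continuousAt_const (by linarith)
  have e2 : ∀ᶠ y in 𝓝 p, ‖fderiv ℝ A y‖ < K :=
    hA'p.continuousAt.norm.eventually_lt continuousAt_const (by linarith)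
  obtain ⟨r₁, hr₁, hball⟩ := Metric.eventually_nhds_iff_ball.1
    ((hΩ.eventually_mem hp).and ((Filter.eventually_of_mem hS fun _ h => h).and (e1.and e2)))
  -- Two points of the ball are at distance at most 2r ≤ 1/(2K). The radius depends neither on the
  -- base point nor on the initial value.
  set r := min r₁ (1 / (4 * K)) with hr
  have hKpos : 0 < K := by linarith
  have hrpos : 0 < r := by positivity
  have hb : ∀ y ∈ ball p r, y ∈ Ω ∧ y ∈ S ∧ ‖A y‖ < K ∧ ‖fderiv ℝ A y‖ < K := fun y hy =>
    hball y (ball_subset_ball (min_le_left _ _) hy)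
  have hconv : Convex ℝ (ball p r) := convex_ball p r
  have hder : ∀ y ∈ ball p r, HasFDerivAt A (fderiv ℝ A y) y := fun y hy =>
    ((hA.contDiffAt (hΩ.mem_nhds (hb y hy).1)).differentiableAt (by simp)).hasFDerivAt
  have hd : ∀ y ∈ ball p r, ∀ z ∈ ball p r, K * ‖z - y‖ ≤ 1 / 2 := by
    intro y hy z hz
    have h1 : ‖z - y‖ ≤ 2 * r := by
      rw [← dist_eq_norm]
      have := dist_triangle_right z y p
      rw [mem_ball] at hy hz
      linarith
    have h2 : r ≤ 1 / (4 * K) := min_le_right _ _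
    calc K * ‖z - y‖ ≤ K * (2 * (1 / (4 * K))) := by gcongr; linarith
      _ = 1 / 2 := by field_simp; norm_num
  refine ⟨r, hrpos, fun y hy => (hb y hy).1, fun y₀ hy₀ w => ?_⟩
  refine exists_solution_of_curvature_eq_zero (A' := fderiv ℝ A) hKpos.le hconv isOpen_ball
    (fun y hy => (hb y hy).2.2.1.le) (fun y hy => (hb y hy).2.2.2.le) hder ?_ ?_ hd ?_
    (fun y hy => hcurv y (hb y hy).1) hy₀ w
  · intro y hy z hz
    exact hconv.norm_image_sub_le_of_norm_hasFDerivWithin_le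
      (fun x hx => (hder x hx).hasFDerivWithinAt) (fun x hx => (hb x hx).2.2.2.le) hy hz
  · intro y hy z hz
    have hseg : segment ℝ y z ⊆ ball p r := hconv.segment_subset hy hz
    have := (convex_segment y z).norm_image_sub_le_of_norm_hasFDerivWithin_le'
      (f := A) (φ := fderiv ℝ A y) (C := K * ‖z - y‖)
      (fun x hx => (hder x (hseg hx)).hasFDerivWithinAt) (fun x hx => ?_)
      (left_mem_segment ℝ y z) (right_mem_segment ℝ y z)
    · refine this.trans (le_of_eq ?_)
      ring
    · have h1 := hlip.norm_sub_le (hb x (hseg hx)).2.1 (hb y hy).2.1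
      refine h1.trans ?_
      have h2 : ‖x - y‖ ≤ ‖z - y‖ := by
        obtain ⟨t, ht, rfl⟩ := (segment_eq_image' ℝ y z) ▸ hx
        simp only [add_sub_cancel_left, norm_smul, Real.norm_of_nonneg ht.1]
        nlinarith [norm_nonneg (z - y), ht.2]
      gcongr
  · intro y hy z hz
    have := hd y hy z hz
    nlinarith [norm_nonneg (z - y)]

end TotalDifferentialEquation

end CottonGravity

namespace CottonGravity

/-! ### Calculus of partial derivatives -/

section Coordinates

open Filter Topology

variable {n : ℕ} {f₁ f₂ f : EuclideanSpace ℝ (Fin n) → ℝ} {y : EuclideanSpace ℝ (Fin n)}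
  {W : Set (EuclideanSpace ℝ (Fin n))} {i j k : Fin n}

theorem sum_smul_single (h : EuclideanSpace ℝ (Fin n)) :
    ∑ i, h i • EuclideanSpace.single i (1 : ℝ) = h := by
  ext j
  simp [Finset.sum_apply, Pi.single_apply]

theorem fderiv_eq_sum_partialDeriv (f : EuclideanSpace ℝ (Fin n) → ℝ)
    (y h : EuclideanSpace ℝ (Fin n)) : fderiv ℝ f y h = ∑ i, h i * partialDeriv i f y := by
  conv_lhs => rw [← sum_smul_single h]
  simp [partialDeriv]

theorem partialDeriv_congr (h : f₁ =ᶠ[𝓝 y] f₂) : partialDeriv i f₁ y = partialDeriv i f₂ y := by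
  rw [partialDeriv, partialDeriv, h.fderiv_eq]

theorem partialDeriv_const (c : ℝ) : partialDeriv i (fun _ => c) y = 0 := by simp [partialDeriv]

theorem partialDeriv_add (h₁ : DifferentiableAt ℝ f₁ y) (h₂ : DifferentiableAt ℝ f₂ y) :
    partialDeriv i (fun z => f₁ z + f₂ z) y = partialDeriv i f₁ y + partialDeriv i f₂ y := by
  simp only [partialDeriv]
  rw [fderiv_fun_add h₁ h₂]
  rfl

theorem partialDeriv_sub (h₁ : DifferentiableAt ℝ f₁ y) (h₂ : DifferentiableAt ℝ f₂ y) :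
    partialDeriv i (fun z => f₁ z - f₂ z) y = partialDeriv i f₁ y - partialDeriv i f₂ y := by
  simp only [partialDeriv]
  rw [fderiv_fun_sub h₁ h₂]
  rfl

theorem partialDeriv_mul (h₁ : DifferentiableAt ℝ f₁ y) (h₂ : DifferentiableAt ℝ f₂ y) :
    partialDeriv i (fun z => f₁ z * f₂ z) y
      = f₁ y * partialDeriv i f₂ y + partialDeriv i f₁ y * f₂ y := by
  simp only [partialDeriv]
  rw [fderiv_fun_mul h₁ h₂]
  simp [mul_comm]

theorem partialDeriv_sum {ι : Type*} (s : Finset ι) {F : ι → EuclideanSpace ℝ (Fin n) → ℝ}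
    (h : ∀ p ∈ s, DifferentiableAt ℝ (F p) y) :
    partialDeriv i (fun z => ∑ p ∈ s, F p z) y = ∑ p ∈ s, partialDeriv i (F p) y := by
  simp only [partialDeriv]
  rw [fderiv_fun_sum h]
  simp

theorem contDiffOn_partialDeriv (hW : IsOpen W) (hf : ContDiffOn ℝ ∞ f W) (i : Fin n) :
    ContDiffOn ℝ ∞ (partialDeriv i f) W :=
  (hf.fderiv_of_isOpen hW (by norm_cast)).clm_apply contDiffOn_const

theorem differentiableAt_of_contDiffOn (hW : IsOpen W) (hf : ContDiffOn ℝ ∞ f W) (hy : y ∈ W) :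
    DifferentiableAt ℝ f y :=
  (hf.contDiffAt (hW.mem_nhds hy)).differentiableAt (by simp)

theorem partialDeriv_comm (hW : IsOpen W) (hf : ContDiffOn ℝ ∞ f W) (hy : y ∈ W) :
    partialDeriv i (partialDeriv j f) y = partialDeriv j (partialDeriv i f) y := by
  have h2 : ContDiffAt ℝ ∞ f y := hf.contDiffAt (hW.mem_nhds hy)
  have h3 : DifferentiableAt ℝ (fderiv ℝ f) y :=
    (h2.fderiv_right (m := 1) (by norm_cast)).differentiableAt (by simp)
  have h4 : ∀ a b : Fin n, partialDeriv a (partialDeriv b f) y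
      = fderiv ℝ (fderiv ℝ f) y (EuclideanSpace.single a 1) (EuclideanSpace.single b 1) := by
    intro a b
    have := h3.hasFDerivAt.clm_apply
      (hasFDerivAt_const (EuclideanSpace.single b (1 : ℝ)) y)
    change fderiv ℝ (fun z => fderiv ℝ f z (EuclideanSpace.single b 1)) y _ = _
    rw [this.fderiv]
    simp
  rw [h4, h4]
  exact (h2.isSymmSndFDerivAt (by simpa using (WithTop.coe_le_coe.2 (le_top : (2 : ℕ∞) ≤ ⊤) : (2 : WithTop ℕ∞) ≤ ∞))) _ _

/-! ### The Levi-Civita connection in coordinates -/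

variable {G C : EuclideanSpace ℝ (Fin n) → Matrix (Fin n) (Fin n) ℝ} {κ : ℝ}

/-- Cramer's rule: entries of the inverse are quotients of determinants, hence smooth where the
determinant is invertible. -/
theorem contDiffOn_matrix_inv {E : Type*} [NormedAddCommGroup E] [NormedSpace ℝ E] {W : Set E}
    {G : E → Matrix (Fin n) (Fin n) ℝ} (hG : ∀ i j, ContDiffOn ℝ ∞ (fun y => G y i j) W)
    (hdet : ∀ y ∈ W, IsUnit (G y).det) (i j : Fin n) :
    ContDiffOn ℝ ∞ (fun y => (G y)⁻¹ i j) W := by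
  have hd : ∀ H : E → Matrix (Fin n) (Fin n) ℝ, (∀ i j, ContDiffOn ℝ ∞ (fun y => H y i j) W) →
      ContDiffOn ℝ ∞ (fun y => (H y).det) W := by
    intro H hH
    simp only [Matrix.det_apply]
    refine ContDiffOn.sum fun σ _ => ContDiffOn.const_smul _ ?_
    exact contDiffOn_prod fun a _ => hH _ _
  have : (fun y => (G y)⁻¹ i j) = fun y => (G y).det⁻¹ * (G y).adjugate i j := by
    ext y
    rw [Matrix.inv_def, Matrix.smul_apply, Ring.inverse_eq_inv', smul_eq_mul]
  rw [this]
  refine (ContDiffOn.inv (hd G hG) fun y hy => (hdet y hy).ne_zero).mul ?_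
  simp only [Matrix.adjugate_apply]
  refine hd _ fun a b => ?_
  by_cases ha : a = j
  · subst ha
    simpa using! contDiffOn_const
  · simpa [Matrix.updateRow_ne ha] using hG a b

theorem contDiffOn_christoffel (hW : IsOpen W) (hG : ∀ i j, ContDiffOn ℝ ∞ (fun y => G y i j) W)
    (hdet : ∀ y ∈ W, IsUnit (G y).det) (k i j : Fin n) :
    ContDiffOn ℝ ∞ (christoffel G k i j) W := by
  refine ContDiffOn.mul contDiffOn_const (ContDiffOn.sum fun l _ => ?_)
  exact (contDiffOn_matrix_inv hG hdet k l).mul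
    (((contDiffOn_partialDeriv hW (hG _ _) _).add (contDiffOn_partialDeriv hW (hG _ _) _)).sub
      (contDiffOn_partialDeriv hW (hG _ _) _))

theorem christoffel_symm (hsymm : ∀ z i j, G z i j = G z j i) (k i j : Fin n) :
    christoffel G k i j y = christoffel G k j i y := by
  simp only [christoffel]
  congr 1
  refine Finset.sum_congr rfl fun l _ => ?_
  have : (fun z => G z i j) = fun z => G z j i := funext fun z => hsymm z i j
  rw [this]
  ring

/-- The Christoffel symbols of the first kind. -/
theorem sum_christoffel_mul (hsymm : ∀ z i j, G z i j = G z j i) (hdet : IsUnit (G y).det)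
    (i j k : Fin n) :
    ∑ p, christoffel G p i j y * G y p k = (1 / 2) *
      (partialDeriv i (fun z => G z j k) y + partialDeriv j (fun z => G z i k) y
        - partialDeriv k (fun z => G z i j) y) := by
  set D := fun l => partialDeriv i (fun z => G z j l) y + partialDeriv j (fun z => G z i l) y
        - partialDeriv l (fun z => G z i j) y
  have hinv : ∀ l, ∑ p, (G y)⁻¹ p l * G y p k = if l = k then 1 else 0 := by
    intro l
    have h1 : (G y * (G y)⁻¹) k l = (1 : Matrix (Fin n) (Fin n) ℝ) k l := by
      rw [Matrix.mul_nonsing_inv _ hdet]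
    rw [Matrix.mul_apply, Matrix.one_apply] at h1
    simp only [hsymm y _ k, mul_comm _ (G y k _), h1, eq_comm]
  calc ∑ p, christoffel G p i j y * G y p k
      = ∑ p, ∑ l, (1 / 2) * (D l * ((G y)⁻¹ p l * G y p k)) := by
        refine Finset.sum_congr rfl fun p _ => ?_
        simp only [christoffel, Finset.mul_sum, Finset.sum_mul]
        refine Finset.sum_congr rfl fun l _ => ?_
        simp only [D]
        ring
    _ = ∑ l, (1 / 2) * (D l * ∑ p, (G y)⁻¹ p l * G y p k) := by
        rw [Finset.sum_comm]
        simp only [Finset.mul_sum]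
    _ = _ := by simp [hinv, D]

/-- The Levi-Civita connection is metric. -/
theorem partialDeriv_metric (hsymm : ∀ z i j, G z i j = G z j i) (hdet : IsUnit (G y).det)
    (i j k : Fin n) :
    partialDeriv i (fun z => G z j k) y
      = ∑ p, christoffel G p i j y * G y p k + ∑ p, christoffel G p i k y * G y p j := by
  rw [sum_christoffel_mul hsymm hdet, sum_christoffel_mul hsymm hdet]
  have : ∀ a b, (fun z => G z a b) = fun z => G z b a := fun a b => funext fun z => hsymm z a b
  rw [this k j]
  ring

/-! ### The total differential equation for φ in coordinates and its integrability. -/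

/-- The second derivatives `∂_j ∂_k φ` that the equation `C = ∇∇φ + κ φ g` prescribes for a function
with value `u.1` and first derivatives `u.2.1`; the tensor `C` has the factor `u.2.2`. -/
noncomputable def prescribedHessian (G C : EuclideanSpace ℝ (Fin n) → Matrix (Fin n) (Fin n) ℝ)
    (κ : ℝ) (j k : Fin n) (y : EuclideanSpace ℝ (Fin n)) (u : ℝ × (Fin n → ℝ) × ℝ) : ℝ :=
  ∑ p, christoffel G p j k y * u.2.1 p - κ * u.1 * G y j k + u.2.2 * C y j k

theorem prescribedHessian_symm (hG : ∀ z i j, G z i j = G z j i) (hC : ∀ z i j, C z i j = C z j i)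
    (j k : Fin n) (u : ℝ × (Fin n → ℝ) × ℝ) :
    prescribedHessian G C κ j k y u = prescribedHessian G C κ k j y u := by
  simp only [prescribedHessian, christoffel_symm hG _ j k, hG y j k, hC y j k]

/-- The Riemann tensor of a metric of constant curvature, with one index up. -/
theorem riemannUp_eq_of_constCurv (hdet : IsUnit (G y).det)
    (hR : ∀ j k l m, riemann G j k l m y = κ * (G y j l * G y k m - G y j m * G y k l))
    (q k i j : Fin n) :
    riemannUp G q k i j y
      = κ * ((if q = i then G y k j else 0) - (if q = j then G y k i else 0)) := by
  have h1 : ∀ a, ∑ m, (G y)⁻¹ q m * G y m a = if q = a then 1 else 0 := by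
    intro a
    have h : ((G y)⁻¹ * G y) q a = (1 : Matrix (Fin n) (Fin n) ℝ) q a := by
      rw [Matrix.nonsing_inv_mul _ hdet]
    rwa [Matrix.mul_apply, Matrix.one_apply] at h
  calc riemannUp G q k i j y
      = ∑ p, (∑ m, (G y)⁻¹ q m * G y m p) * riemannUp G p k i j y := by simp [h1]
    _ = ∑ m, (G y)⁻¹ q m * riemann G m k i j y := by
        simp only [riemann, Finset.sum_mul, Finset.mul_sum]
        rw [Finset.sum_comm]
        simp only [mul_assoc]
    _ = κ * ((∑ m, (G y)⁻¹ q m * G y m i) * G y k j - (∑ m, (G y)⁻¹ q m * G y m j) * G y k i) := by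
        simp only [hR, Finset.sum_mul, Finset.mul_sum, mul_sub, ← Finset.sum_sub_distrib]
        refine Finset.sum_congr rfl fun m _ => ?_
        ring
    _ = _ := by simp [h1]

/-- For a metric of constant curvature, the curvature of the total differential equation
`C = ∇∇φ + κ φ g` is the Codazzi defect of `C`. -/
theorem curvature_prescribedHessian (hsymm : ∀ z i j, G z i j = G z j i)
    (hdet : IsUnit (G y).det)
    (hR : ∀ j k l m, riemann G j k l m y = κ * (G y j l * G y k m - G y j m * G y k l))
    (i j k : Fin n) (φ c : ℝ) (u : Fin n → ℝ) :
    ((∑ p, partialDeriv i (christoffel G p j k) y * u p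
        - κ * φ * partialDeriv i (fun z => G z j k) y + c * partialDeriv i (fun z => C z j k) y)
      + prescribedHessian G C κ j k y (u i, fun p => prescribedHessian G C κ i p y (φ, u, c), 0))
    - ((∑ p, partialDeriv j (christoffel G p i k) y * u p
        - κ * φ * partialDeriv j (fun z => G z i k) y + c * partialDeriv j (fun z => C z i k) y)
      + prescribedHessian G C κ i k y (u j, fun p => prescribedHessian G C κ j p y (φ, u, c), 0))
    = c * (covDeriv G C i j k y - covDeriv G C j i k y) := by
  have hΓ : ∀ p, christoffel G p j i y = christoffel G p i j y := fun p =>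
    christoffel_symm hsymm p j i
  -- Constant curvature enters here: the Riemann tensor contracted with the gradient is exactly what
  -- the derivative of κφg contributes through ∂φ.
  have hriem : ∑ q, u q * riemannUp G q k i j y = κ * (u i * G y k j - u j * G y k i) := by
    simp only [riemannUp_eq_of_constCurv hdet hR, mul_sub, Finset.sum_sub_distrib]
    simp
    ring
  have hcomp : ∀ a b : Fin n, ∑ p, christoffel G p b k y * ∑ q, christoffel G q a p y * u q
      = ∑ q, u q * ∑ p, christoffel G q a p y * christoffel G p b k y := by
    intro a b
    simp only [Finset.mul_sum]
    rw [Finset.sum_comm]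
    refine Finset.sum_congr rfl fun q _ => Finset.sum_congr rfl fun p _ => ?_
    ring
  -- The last slot is 0 because it holds the derivative of the constant coordinate; the factor c of
  -- C comes back through the inner `prescribedHessian`.
  have hexp : ∀ a b : Fin n,
      prescribedHessian G C κ b k y (u a, fun p => prescribedHessian G C κ a p y (φ, u, c), 0)
      = ∑ p, christoffel G p b k y * ∑ q, christoffel G q a p y * u q
        - κ * φ * ∑ p, christoffel G p b k y * G y p a
        + c * ∑ p, christoffel G p b k y * C y a p - κ * u a * G y b k := by
    intro a b
    simp only [prescribedHessian, mul_add, mul_sub, Finset.sum_add_distrib,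
      Finset.sum_sub_distrib, Finset.mul_sum, zero_mul, add_zero, hsymm y _ a]
    congr 1
    congr 1
    · congr 1
      refine Finset.sum_congr rfl fun p _ => ?_
      ring
    · refine Finset.sum_congr rfl fun p _ => ?_
      ring
  have hr : ∑ q, u q * riemannUp G q k i j y
      = ∑ p, partialDeriv i (christoffel G p j k) y * u p
        - ∑ p, partialDeriv j (christoffel G p i k) y * u p
        + (∑ q, u q * ∑ p, christoffel G q i p y * christoffel G p j k y
        - ∑ q, u q * ∑ p, christoffel G q j p y * christoffel G p i k y) := by
    simp only [riemannUp, ← Finset.sum_sub_distrib, ← Finset.sum_add_distrib,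
      mul_add, mul_sub, Finset.mul_sum]
    refine Finset.sum_congr rfl fun q _ => ?_
    ring
  rw [hexp i j, hexp j i, hcomp i j, hcomp j i, partialDeriv_metric hsymm hdet i j k,
    partialDeriv_metric hsymm hdet j i k]
  simp only [covDeriv, Finset.sum_add_distrib, hΓ]
  rw [hr] at hriem
  rw [hsymm y j k, hsymm y i k]
  -- The φ-terms are already cancelled by metric compatibility and the symmetry of the Christoffel
  -- symbols; the terms in u cancel by `hriem`.
  linear_combination hriem

/-- The total differential equation `C = ∇∇φ + κ φ g` for the value and the first derivatives
of `φ`. -/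
noncomputable def ferusSystem (G C : EuclideanSpace ℝ (Fin n) → Matrix (Fin n) (Fin n) ℝ) (κ : ℝ)
    (y : EuclideanSpace ℝ (Fin n)) :
    EuclideanSpace ℝ (Fin n) →L[ℝ] (ℝ × (Fin n → ℝ) × ℝ) →L[ℝ] (ℝ × (Fin n → ℝ) × ℝ) :=
  ∑ i, (EuclideanSpace.proj i : EuclideanSpace ℝ (Fin n) →L[ℝ] ℝ).smulRight
    (LinearMap.toContinuousLinearMap
      -- The final 0 keeps the homogenizing coordinate constant along solutions.
      { toFun := fun u => (u.2.1 i, fun k => prescribedHessian G C κ i k y u, 0)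
        map_add' := fun u v => by
          ext k
          · simp
          · simp only [prescribedHessian, Prod.snd_add, Prod.fst_add, Pi.add_apply, mul_add,
              Finset.sum_add_distrib]
            ring
          · simp
        map_smul' := fun a u => by
          ext k
          · simp
          · simp only [prescribedHessian, Prod.smul_snd, Prod.smul_fst, Pi.smul_apply, smul_eq_mul,
              RingHom.id_apply, mul_add, mul_sub, Finset.mul_sum]
            congr 1
            · congr 1
              · refine Finset.sum_congr rfl fun p _ => ?_
                ring
              · ring
            · ring
          · simp })

theorem ferusSystem_apply (h : EuclideanSpace ℝ (Fin n)) (u : ℝ × (Fin n → ℝ) × ℝ) :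
    ferusSystem G C κ y h u
      = (∑ i, h i * u.2.1 i, fun k => ∑ i, h i * prescribedHessian G C κ i k y u, 0) := by
  simp only [ferusSystem, sum_apply, ContinuousLinearMap.smulRight_apply, smul_apply,
    LinearMap.coe_toContinuousLinearMap', LinearMap.coe_mk, AddHom.coe_mk]
  ext k
  · simp [Prod.fst_sum]
  · simp [Prod.fst_sum, Prod.snd_sum]
  · simp [Prod.snd_sum]

theorem ferusSystem_single (i : Fin n) (u : ℝ × (Fin n → ℝ) × ℝ) :
    ferusSystem G C κ y (EuclideanSpace.single i 1) u
      = (u.2.1 i, fun k => prescribedHessian G C κ i k y u, 0) := by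
  rw [ferusSystem_apply]
  simp

theorem contDiffOn_prescribedHessian (hW : IsOpen W)
    (hG : ∀ i j, ContDiffOn ℝ ∞ (fun y => G y i j) W)
    (hC : ∀ i j, ContDiffOn ℝ ∞ (fun y => C y i j) W)
    (hdet : ∀ y ∈ W, IsUnit (G y).det) (j k : Fin n) (u : ℝ × (Fin n → ℝ) × ℝ) :
    ContDiffOn ℝ ∞ (fun y => prescribedHessian G C κ j k y u) W := by
  refine ((ContDiffOn.sum fun p _ => ?_).sub (contDiffOn_const.mul (hG j k))).add
    (contDiffOn_const.mul (hC j k))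
  exact (contDiffOn_christoffel hW hG hdet p j k).mul contDiffOn_const

theorem contDiffOn_ferusSystem (hW : IsOpen W)
    (hG : ∀ i j, ContDiffOn ℝ ∞ (fun y => G y i j) W)
    (hC : ∀ i j, ContDiffOn ℝ ∞ (fun y => C y i j) W)
    (hdet : ∀ y ∈ W, IsUnit (G y).det) : ContDiffOn ℝ ∞ (ferusSystem G C κ) W := by
  refine contDiffOn_clm_apply.2 fun h => contDiffOn_clm_apply.2 fun u => ?_
  simp only [ferusSystem_apply]
  refine contDiffOn_const.prodMk (ContDiffOn.prodMk (contDiffOn_pi.2 fun k => ?_) contDiffOn_const)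
  exact ContDiffOn.sum fun i _ =>
    contDiffOn_const.mul (contDiffOn_prescribedHessian hW hG hC hdet i k u)

/-- The product rule, grouped as in `curvature_prescribedHessian`: derivatives of the coefficients
first, then the same linear expression in the derivatives of the jet. It is used with a constant jet
for the curvature of the system, and with the jet of f for third derivatives. -/
theorem partialDeriv_prescribedHessian (hW : IsOpen W)
    (hG : ∀ i j, ContDiffOn ℝ ∞ (fun y => G y i j) W)
    (hC : ∀ i j, ContDiffOn ℝ ∞ (fun y => C y i j) W)
    (hdet : ∀ y ∈ W, IsUnit (G y).det) (hy : y ∈ W) (i j k : Fin n)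
    {φ c : EuclideanSpace ℝ (Fin n) → ℝ} {u : Fin n → EuclideanSpace ℝ (Fin n) → ℝ}
    (hφ : DifferentiableAt ℝ φ y) (hc : DifferentiableAt ℝ c y)
    (hu : ∀ p, DifferentiableAt ℝ (u p) y) :
    partialDeriv i (fun z => prescribedHessian G C κ j k z (φ z, fun p => u p z, c z)) y
      = (∑ p, partialDeriv i (christoffel G p j k) y * u p y
        - κ * φ y * partialDeriv i (fun z => G z j k) y
        + c y * partialDeriv i (fun z => C z j k) y)
      + prescribedHessian G C κ j k y
          (partialDeriv i φ y, fun p => partialDeriv i (u p) y, partialDeriv i c y) := by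
  have dΓ : ∀ p, DifferentiableAt ℝ (christoffel G p j k) y := fun p =>
    differentiableAt_of_contDiffOn hW (contDiffOn_christoffel hW hG hdet p j k) hy
  have dG := differentiableAt_of_contDiffOn hW (hG j k) hy
  have dC := differentiableAt_of_contDiffOn hW (hC j k) hy
  have dS : DifferentiableAt ℝ (fun z => ∑ p, christoffel G p j k z * u p z) y :=
    DifferentiableAt.fun_sum fun p _ => (dΓ p).mul (hu p)
  have dκφ : DifferentiableAt ℝ (fun z => κ * φ z) y := hφ.const_mul κ
  simp only [prescribedHessian]
  rw [partialDeriv_add (dS.fun_sub (dκφ.fun_mul dG)) (hc.fun_mul dC),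
    partialDeriv_sub dS (dκφ.fun_mul dG), partialDeriv_sum _ (fun p _ => (dΓ p).fun_mul (hu p)), partialDeriv_mul dκφ dG,
    partialDeriv_mul hc dC, partialDeriv_mul (differentiableAt_const κ) hφ, partialDeriv_const]
  simp only [partialDeriv_mul (dΓ _) (hu _), Finset.sum_add_distrib]
  ring

/-- Reduces the curvature identity to coordinate directions. Bilinearity is taken as a hypothesis so
that both sides can remain plain expressions. -/
theorem eq_of_eq_on_single {F : Type*} [AddCommGroup F] [Module ℝ F]
    {B B' : EuclideanSpace ℝ (Fin n) → EuclideanSpace ℝ (Fin n) → F}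
    (h₁ : ∀ k, IsLinearMap ℝ fun h => B h k) (h₂ : ∀ h, IsLinearMap ℝ (B h))
    (h₁' : ∀ k, IsLinearMap ℝ fun h => B' h k) (h₂' : ∀ h, IsLinearMap ℝ (B' h))
    (he : ∀ i j, B (EuclideanSpace.single i 1) (EuclideanSpace.single j 1)
      = B' (EuclideanSpace.single i 1) (EuclideanSpace.single j 1))
    (h k : EuclideanSpace ℝ (Fin n)) : B h k = B' h k := by
  have hb : ∀ {B : EuclideanSpace ℝ (Fin n) → EuclideanSpace ℝ (Fin n) → F},
      (∀ k, IsLinearMap ℝ fun h => B h k) → (∀ h, IsLinearMap ℝ (B h)) →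
      B h k = ∑ i, ∑ j, h i • k j • B (EuclideanSpace.single i 1) (EuclideanSpace.single j 1) := by
    intro B b₁ b₂
    have e₁ : B h k = ∑ i, h i • B (EuclideanSpace.single i 1) k := by
      conv_lhs => rw [← sum_smul_single h]
      exact (map_sum (b₁ k).mk' _ _).trans
        (Finset.sum_congr rfl fun i _ => (b₁ k).map_smul _ _)
    have e₂ : ∀ v, B v k = ∑ j, k j • B v (EuclideanSpace.single j 1) := by
      intro v
      conv_lhs => rw [← sum_smul_single k]
      exact (map_sum (b₂ v).mk' _ _).trans
        (Finset.sum_congr rfl fun i _ => (b₂ v).map_smul _ _)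
    rw [e₁]
    simp only [e₂, Finset.smul_sum]
  rw [hb h₁ h₂, hb h₁' h₂']
  simp only [he]

/-- For a Codazzi tensor, the total differential equation `C = ∇∇φ + κ φ g` on a space of constant
curvature has vanishing curvature. -/
theorem curvature_ferusSystem (hW : IsOpen W)
    (hG : ∀ i j, ContDiffOn ℝ ∞ (fun y => G y i j) W)
    (hC : ∀ i j, ContDiffOn ℝ ∞ (fun y => C y i j) W)
    (hdet : ∀ y ∈ W, IsUnit (G y).det) (hGs : ∀ z i j, G z i j = G z j i)
    (hCs : ∀ z i j, C z i j = C z j i)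
    (hR : ∀ y ∈ W, ∀ j k l m,
      riemann G j k l m y = κ * (G y j l * G y k m - G y j m * G y k l))
    (hcod : ∀ y ∈ W, ∀ i j k, covDeriv G C i j k y = covDeriv G C j i k y)
    (hy : y ∈ W) (h k : EuclideanSpace ℝ (Fin n)) (u : ℝ × (Fin n → ℝ) × ℝ) :
    fderiv ℝ (ferusSystem G C κ) y h k u + ferusSystem G C κ y k (ferusSystem G C κ y h u)
      = fderiv ℝ (ferusSystem G C κ) y k h u
        + ferusSystem G C κ y h (ferusSystem G C κ y k u) := by
  have hd : DifferentiableAt ℝ (ferusSystem G C κ) y :=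
    ((contDiffOn_ferusSystem hW hG hC hdet).contDiffAt (hW.mem_nhds hy)).differentiableAt (by simp)
  refine eq_of_eq_on_single
    (B := fun h k => fderiv ℝ (ferusSystem G C κ) y h k u
      + ferusSystem G C κ y k (ferusSystem G C κ y h u))
    (B' := fun h k => fderiv ℝ (ferusSystem G C κ) y k h u
      + ferusSystem G C κ y h (ferusSystem G C κ y k u)) ?_ ?_ ?_ ?_ ?_ h k
  iterate 4
    intro v
    constructor
    · intro a b
      simp only [map_add, add_apply]
      abel
    · intro a b
      simp only [map_smul, smul_apply, smul_add]
  intro i j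
  have hder : ∀ a b : Fin n, fderiv ℝ (ferusSystem G C κ) y (EuclideanSpace.single a 1)
      (EuclideanSpace.single b 1) u
      = (0, fun k => partialDeriv a (fun z => prescribedHessian G C κ b k z u) y, 0) := by
    intro a b
    have h1 : HasFDerivAt (fun z => ferusSystem G C κ z (EuclideanSpace.single b 1) u)
        (((fderiv ℝ (ferusSystem G C κ) y).flip (EuclideanSpace.single b 1)).flip u) y := by
      have := (hd.hasFDerivAt.clm_apply
        (hasFDerivAt_const (EuclideanSpace.single b (1 : ℝ)) y)).clm_apply (hasFDerivAt_const u y)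
      refine this.congr_fderiv ?_
      ext1 v
      simp
    simp only [ferusSystem_single] at h1
    have h2 : HasFDerivAt (fun z => ((u.2.1 b, fun k => prescribedHessian G C κ b k z u, 0) :
        ℝ × (Fin n → ℝ) × ℝ)) ((0 : EuclideanSpace ℝ (Fin n) →L[ℝ] ℝ).prod
          ((ContinuousLinearMap.pi fun k =>
            fderiv ℝ (fun z => prescribedHessian G C κ b k z u) y).prod 0)) y := by
      refine (hasFDerivAt_const _ _).prodMk (HasFDerivAt.prodMk (hasFDerivAt_pi.2 fun k => ?_)
        (hasFDerivAt_const _ _))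
      exact (differentiableAt_of_contDiffOn hW
        (contDiffOn_prescribedHessian hW hG hC hdet b k u) hy).hasFDerivAt
    exact congrArg (fun L => L (EuclideanSpace.single a (1 : ℝ))) (h1.unique h2)
  simp only [hder, ferusSystem_single]
  ext k
  -- The component for φ is the symmetry of the prescribed Hessian, the components for ∂φ are the
  -- Codazzi equation, and the last one is trivial.
  · simp [prescribedHessian_symm hGs hCs i j]
  · have hpd : ∀ a b : Fin n, partialDeriv a (fun z => prescribedHessian G C κ b k z u) y
        = ∑ p, partialDeriv a (christoffel G p b k) y * u.2.1 p
        - κ * u.1 * partialDeriv a (fun z => G z b k) y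
        + u.2.2 * partialDeriv a (fun z => C z b k) y := by
      intro a b
      have := partialDeriv_prescribedHessian (κ := κ) (φ := fun _ => u.1) (c := fun _ => u.2.2)
        (u := fun p _ => u.2.1 p) hW hG hC hdet hy a b k (differentiableAt_const _)
        (differentiableAt_const _) (fun p => differentiableAt_const _)
      refine this.trans ?_
      simp [partialDeriv_const, prescribedHessian]
    have := curvature_prescribedHessian (C := C) hGs (hdet y hy) (hR y hy) i j k u.1 u.2.2 u.2.1
    rw [hcod y hy i j k, sub_self, mul_zero, sub_eq_zero] at this
    simpa [hpd] using this
  · simp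

/-- The value and first derivatives of a function with `C = ∇∇f + κ f g` solve the total
differential equation. -/
theorem hasFDerivAt_jet (hW : IsOpen W) (hf : ContDiffOn ℝ ∞ f W) (hy : y ∈ W)
    (hform : ∀ j k, C y j k = hessian G f y j k + κ * f y * G y j k) :
    HasFDerivAt (fun z => ((f z, fun p => partialDeriv p f z, 1) : ℝ × (Fin n → ℝ) × ℝ))
      ((ferusSystem G C κ y).flip (f y, fun p => partialDeriv p f y, 1)) y := by
  have h1 : HasFDerivAt (fun z => ((f z, fun p => partialDeriv p f z, 1) : ℝ × (Fin n → ℝ) × ℝ))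
      ((fderiv ℝ f y).prod ((ContinuousLinearMap.pi fun k =>
        fderiv ℝ (partialDeriv k f) y).prod 0)) y := by
    refine (differentiableAt_of_contDiffOn hW hf hy).hasFDerivAt.prodMk
      (HasFDerivAt.prodMk (hasFDerivAt_pi.2 fun k => ?_) (hasFDerivAt_const _ _))
    exact (differentiableAt_of_contDiffOn hW (contDiffOn_partialDeriv hW hf k) hy).hasFDerivAt
  refine h1.congr_fderiv ?_
  ext1 h
  rw [ContinuousLinearMap.flip_apply, ferusSystem_apply]
  ext k
  · exact fderiv_eq_sum_partialDeriv f y h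
  · refine (fderiv_eq_sum_partialDeriv _ y h).trans (Finset.sum_congr rfl fun i _ => ?_)
    congr 1
    have := hform i k
    simp only [hessian, Matrix.of_apply] at this
    simp only [prescribedHessian, this]
    ring
  · rfl

/-- Tensors of the form `∇∇f + κ f g` on a space of constant curvature are Codazzi tensors. -/
theorem codazzi_of_form (hW : IsOpen W)
    (hG : ∀ i j, ContDiffOn ℝ ∞ (fun y => G y i j) W)
    (hC : ∀ i j, ContDiffOn ℝ ∞ (fun y => C y i j) W)
    (hdet : ∀ y ∈ W, IsUnit (G y).det) (hGs : ∀ z i j, G z i j = G z j i)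
    (hR : ∀ y ∈ W, ∀ j k l m,
      riemann G j k l m y = κ * (G y j l * G y k m - G y j m * G y k l))
    (hf : ContDiffOn ℝ ∞ f W)
    (hform : ∀ y ∈ W, ∀ j k, C y j k = hessian G f y j k + κ * f y * G y j k)
    (hy : y ∈ W) (i j k : Fin n) : covDeriv G C i j k y = covDeriv G C j i k y := by
  have hS : ∀ z ∈ W, ∀ a b, partialDeriv a (partialDeriv b f) z
      = prescribedHessian G C κ a b z (f z, fun p => partialDeriv p f z, 1) := by
    intro z hz a b
    simp only [prescribedHessian, hform z hz a b, hessian, Matrix.of_apply]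
    ring
  have hd : ∀ p, DifferentiableAt ℝ (partialDeriv p f) y := fun p =>
    differentiableAt_of_contDiffOn hW (contDiffOn_partialDeriv hW hf p) hy
  have h3 : ∀ a b, partialDeriv a (partialDeriv b (partialDeriv k f)) y
      = (∑ p, partialDeriv a (christoffel G p b k) y * partialDeriv p f y
        - κ * f y * partialDeriv a (fun z => G z b k) y
        + 1 * partialDeriv a (fun z => C z b k) y)
      + prescribedHessian G C κ b k y (partialDeriv a f y,
          fun p => prescribedHessian G C κ a p y (f y, fun p => partialDeriv p f y, 1), 0) := by
    intro a b
    rw [partialDeriv_congr (f₂ := fun z => prescribedHessian G C κ b k z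
      (f z, fun p => partialDeriv p f z, 1)) (by
        filter_upwards [hW.mem_nhds hy] with z hz using hS z hz b k)]
    rw [partialDeriv_prescribedHessian (c := fun _ => 1) (u := fun p => partialDeriv p f)
      hW hG hC hdet hy a b k (differentiableAt_of_contDiffOn hW hf hy) (differentiableAt_const _) hd]
    simp only [hS y hy, partialDeriv_const]
  -- Commuting third derivatives force the curvature expression to vanish at the jet of f; with c =
  -- 1 it equals the Codazzi defect.
  have hcomm := partialDeriv_comm (i := i) (j := j) hW (contDiffOn_partialDeriv hW hf k) hy
  rw [h3, h3] at hcomm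
  have := curvature_prescribedHessian (C := C) hGs (hdet y hy) (hR y hy) i j k (f y) 1
    (fun p => partialDeriv p f y)
  linarith

/-- Two functions with `C = ∇∇f + κ f g` on a convex set agree if their values and first
derivatives agree at one point. -/
theorem eqOn_of_form (hW : IsOpen W) (hconv : Convex ℝ W)
    (hG : ∀ i j, ContDiffOn ℝ ∞ (fun y => G y i j) W)
    (hC : ∀ i j, ContDiffOn ℝ ∞ (fun y => C y i j) W)
    (hdet : ∀ y ∈ W, IsUnit (G y).det)
    (hf₁ : ContDiffOn ℝ ∞ f₁ W) (hf₂ : ContDiffOn ℝ ∞ f₂ W)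
    (hform₁ : ∀ y ∈ W, ∀ j k, C y j k = hessian G f₁ y j k + κ * f₁ y * G y j k)
    (hform₂ : ∀ y ∈ W, ∀ j k, C y j k = hessian G f₂ y j k + κ * f₂ y * G y j k)
    (hy : y ∈ W) (h0 : f₁ y = f₂ y) (h1 : ∀ i, partialDeriv i f₁ y = partialDeriv i f₂ y) :
    EqOn f₁ f₂ W := by
  have := solution_unique hconv (contDiffOn_ferusSystem (κ := κ) hW hG hC hdet).continuousOn
    (fun z hz => hasFDerivAt_jet hW hf₁ hz (hform₁ z hz))
    (fun z hz => hasFDerivAt_jet hW hf₂ hz (hform₂ z hz)) hy (by simp [h0, h1])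
  exact fun z hz => congrArg Prod.fst (this hz)

/-- On a small ball around a point of a space of constant curvature, the equation
`C = ∇∇f + κ f g` for a Codazzi tensor `C` has a solution with any value and first derivatives at
any point. -/
theorem exists_ball_forall_exists_form {Ω : Set (EuclideanSpace ℝ (Fin n))} (hΩ : IsOpen Ω)
    (hG : ∀ i j, ContDiffOn ℝ ∞ (fun y => G y i j) Ω)
    (hC : ∀ i j, ContDiffOn ℝ ∞ (fun y => C y i j) Ω)
    (hdet : ∀ y ∈ Ω, IsUnit (G y).det) (hGs : ∀ z i j, G z i j = G z j i)
    (hCs : ∀ z i j, C z i j = C z j i)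
    (hR : ∀ y ∈ Ω, ∀ j k l m,
      riemann G j k l m y = κ * (G y j l * G y k m - G y j m * G y k l))
    (hcod : ∀ y ∈ Ω, ∀ i j k, covDeriv G C i j k y = covDeriv G C j i k y)
    {p : EuclideanSpace ℝ (Fin n)} (hp : p ∈ Ω) :
    ∃ r > 0, Metric.ball p r ⊆ Ω ∧ ∀ q ∈ Metric.ball p r, ∀ (a : ℝ) (b : Fin n → ℝ),
      ∃ f : EuclideanSpace ℝ (Fin n) → ℝ, ContDiffOn ℝ ∞ f (Metric.ball p r) ∧ f q = a ∧
        (∀ i, partialDeriv i f q = b i) ∧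
        ∀ y ∈ Metric.ball p r, ∀ j k, C y j k = hessian G f y j k + κ * f y * G y j k := by
  have hA := contDiffOn_ferusSystem (κ := κ) hΩ hG hC hdet
  obtain ⟨r, hr, hsub, hsol⟩ := exists_ball_forall_exists_solution hΩ hA
    (fun y hy h k u => curvature_ferusSystem hΩ hG hC hdet hGs hCs hR hcod hy h k u) hp
  refine ⟨r, hr, hsub, fun q hq a b => ?_⟩
  -- The initial value 1 of the last coordinate persists on the ball (`d3`), which restores the
  -- inhomogeneous equation; `d1` identifies the middle coordinates with the gradient.
  obtain ⟨u, hu0, hu⟩ := hsol q hq (a, b, 1)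
  have hus := contDiffOn_solution Metric.isOpen_ball (hA.mono hsub) hu
  have d1 : ∀ y ∈ Metric.ball p r, ∀ i, partialDeriv i (fun z => (u z).1) y = (u y).2.1 i := by
    intro y hy i
    rw [partialDeriv, ((hu y hy).fst).fderiv]
    simp [ferusSystem_single]
  have d2 : ∀ y ∈ Metric.ball p r, ∀ i j, partialDeriv i (fun z => (u z).2.1 j) y
      = prescribedHessian G C κ i j y (u y) := by
    intro y hy i j
    rw [partialDeriv, (hasFDerivAt_pi'.1 ((hu y hy).snd.fst) j).fderiv]
    simp [ferusSystem_single]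
  have d3 : ∀ y ∈ Metric.ball p r, (u y).2.2 = 1 := by
    intro y hy
    have h0 : ∀ z ∈ Metric.ball p r, HasFDerivWithinAt (fun z => (u z).2.2)
        (0 : EuclideanSpace ℝ (Fin n) →L[ℝ] ℝ) (Metric.ball p r) z := by
      intro z hz
      refine ((hu z hz).snd.snd.congr_fderiv ?_).hasFDerivWithinAt
      ext1 h
      simp [ferusSystem_apply]
    have := (convex_ball p r).norm_image_sub_le_of_norm_hasFDerivWithin_le h0
      (C := 0) (by simp) hq hy
    simp only [zero_mul, norm_le_zero_iff, sub_eq_zero] at this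
    rw [this, hu0]
  refine ⟨fun z => (u z).1, contDiff_fst.comp_contDiffOn hus, by simp [hu0], ?_, ?_⟩
  · intro i
    rw [d1 q hq, hu0]
  · intro y hy j k
    have h2 : partialDeriv j (partialDeriv k fun z => (u z).1) y
        = prescribedHessian G C κ j k y (u y) := by
      rw [← d2 y hy j k]
      refine partialDeriv_congr ?_
      filter_upwards [Metric.isOpen_ball.mem_nhds hy] with z hz using d1 z hz k
    simp only [hessian, Matrix.of_apply, h2, d1 y hy, prescribedHessian, d3 y hy]
    ring

end Coordinates

end CottonGravity

namespace CottonGravity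

/-! ### Gluing of locally determined families of functions -/

section Gluing

open Filter Topology

variable {M F β : Type*} [TopologicalSpace M]

/-- The covering space of the germs of the local families `φ p`. -/
noncomputable def germCore [TopologicalSpace F] [DiscreteTopology F] (U : M → Set M)
    (hU : ∀ p, IsOpen (U p)) (hmem : ∀ p, p ∈ U p) (φ : M → F → M → β)
    (h : ∀ p q, ∀ x ∈ U p ∩ U q, ∀ a, ∃! b, φ p a =ᶠ[𝓝 x] φ q b) : FiberBundleCore M M F := by
  classical
  let cc : M → M → M → F → F := fun p q x a =>
    -- The value off the overlap is arbitrary.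
    if hx : x ∈ U p ∩ U q then (h p q x hx a).choose else a
  have hcc : ∀ p q, ∀ x ∈ U p ∩ U q, ∀ a, φ p a =ᶠ[𝓝 x] φ q (cc p q x a) := by
    intro p q x hx a
    simp only [cc, dif_pos hx]
    exact (h p q x hx a).choose_spec.1
  exact
    { baseSet := U
      isOpen_baseSet := hU
      indexAt := id
      mem_baseSet_at := hmem
      coordChange := cc
      coordChange_self := fun p x hx v =>
        (h p p x ⟨hx, hx⟩ v).unique (hcc p p x ⟨hx, hx⟩ v) EventuallyEq.rfl
      continuousOn_coordChange := by
        rintro p q ⟨x, a⟩ ⟨hx, -⟩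
        -- Equality of germs at x persists at nearby points, so by uniqueness the transition maps
        -- are locally constant in x.
        have he : ∀ᶠ z : M × F in 𝓝 (x, a), cc p q z.1 z.2 = cc p q x a := by
          rw [nhds_prod_eq, nhds_discrete F, prod_pure, eventually_map]
          filter_upwards [(hcc p q x hx a).eventuallyEq_nhds,
            ((hU p).inter (hU q)).mem_nhds hx] with z hz hzU
          exact (h p q z hzU a).unique (hcc p q z hzU a) hz
        exact (continuousAt_const.congr (he.mono fun z hz => hz.symm)).continuousWithinAt
      coordChange_comp := fun p q r x hx v =>
        (h p r x ⟨hx.1.1, hx.2⟩ v).unique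
          ((hcc p q x hx.1 v).trans (hcc q r x ⟨hx.1.2, hx.2⟩ _)) (hcc p r x ⟨hx.1.1, hx.2⟩ v) }

theorem germCore_coordChange [TopologicalSpace F] [DiscreteTopology F] (U : M → Set M)
    (hU : ∀ p, IsOpen (U p)) (hmem : ∀ p, p ∈ U p) (φ : M → F → M → β)
    (h : ∀ p q, ∀ x ∈ U p ∩ U q, ∀ a, ∃! b, φ p a =ᶠ[𝓝 x] φ q b) {p q x : M}
    (hx : x ∈ U p ∩ U q) (a : F) :
    φ p a =ᶠ[𝓝 x] φ q ((germCore U hU hmem φ h).coordChange p q x a) := by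
  simp only [germCore, dif_pos hx]
  exact (h p q x hx a).choose_spec.1

/-- On a simply connected space, local families of functions of which each germ of a member of one
family is the germ of exactly one member of any other family can be glued to a global function. -/
theorem exists_global_of_germs [SimplyConnectedSpace M] [LocallyPathConnectedSpace M] [Nonempty F]
    (U : M → Set M) (hU : ∀ p, IsOpen (U p)) (hmem : ∀ p, p ∈ U p) (φ : M → F → M → β)
    (h : ∀ p q, ∀ x ∈ U p ∩ U q, ∀ a, ∃! b, φ p a =ᶠ[𝓝 x] φ q b) :
    ∃ Φ : M → β, ∀ x, ∃ a, Φ =ᶠ[𝓝 x] φ x a := by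
  -- With the discrete topology on the fibre the bundle of germs is a covering, whatever topology
  -- the parameters may carry otherwise.
  let : TopologicalSpace F := ⊥
  have : DiscreteTopology F := ⟨rfl⟩
  set Z := germCore U hU hmem φ h
  have hcov : IsCoveringMap Z.proj :=
    IsCoveringMap.mk _ (fun _ => F) (fun x => Z.localTriv x) hmem
  obtain ⟨x₀⟩ : Nonempty M := inferInstance
  obtain ⟨a₀⟩ : Nonempty F := inferInstance
  -- The lift of the identity is a section: a continuous choice of a germ at every point.
  obtain ⟨s, ⟨-, hs⟩, -⟩ := hcov.existsUnique_continuousMap_lifts (ContinuousMap.id M) x₀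
    (⟨x₀, a₀⟩ : Z.TotalSpace) rfl
  have hs1 : ∀ x, (s x).1 = x := fun x => congrFun hs x
  let v : M → F := fun x => (s x).2
  refine ⟨fun x => φ x (v x) x, fun x => ?_⟩
  have hx : s x ∈ (Z.localTriv x).source := by
    rw [Z.mem_localTriv_source, hs1]
    exact hmem x
  have hc : ContinuousAt (fun z => (Z.localTriv x (s z)).2) x :=
    continuous_snd.continuousAt.comp
      (((Z.localTriv x).toOpenPartialHomeomorph.continuousAt hx).comp s.continuous.continuousAt)
  have hval : ∀ z, (Z.localTriv x (s z)).2 = Z.coordChange z x z (v z) := by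
    intro z
    change Z.coordChange (s z).1 x (s z).1 (s z).2 = _
    rw [hs1]
  simp only [hval] at hc
  refine ⟨Z.coordChange x x x (v x), ?_⟩
  -- Read in the trivialization at x, the section is continuous into a discrete space, so it names
  -- one member of the family near x.
  have hev : ∀ᶠ z in 𝓝 x, Z.coordChange z x z (v z) = Z.coordChange x x x (v x) := by
    have := hc (isOpen_discrete {Z.coordChange x x x (v x)} |>.mem_nhds rfl)
    exact this
  filter_upwards [hev, (hU x).mem_nhds (hmem x)] with z hz hzU
  rw [← hz]
  exact (germCore_coordChange U hU hmem φ h ⟨hmem z, hzU⟩ (v z)).self_of_nhds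

end Gluing

end CottonGravity

namespace CottonGravity

/-! ### Change of coordinates -/

section ChangeOfCoordinates

open Filter Topology

variable {n : ℕ} {W Ω : Set (EuclideanSpace ℝ (Fin n))}
  {ψ : EuclideanSpace ℝ (Fin n) → EuclideanSpace ℝ (Fin n)} {f : EuclideanSpace ℝ (Fin n) → ℝ}
  {G G' : EuclideanSpace ℝ (Fin n) → Matrix (Fin n) (Fin n) ℝ} {y : EuclideanSpace ℝ (Fin n)}

/-- The Jacobian matrix `∂ψ^i/∂y^a`. -/
noncomputable def jacobian (ψ : EuclideanSpace ℝ (Fin n) → EuclideanSpace ℝ (Fin n))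
    (y : EuclideanSpace ℝ (Fin n)) : Matrix (Fin n) (Fin n) ℝ :=
  Matrix.of fun i a => partialDeriv a (fun z => ψ z i) y

theorem contDiffOn_coord (hψ : ContDiffOn ℝ ∞ ψ W) (i : Fin n) :
    ContDiffOn ℝ ∞ (fun z => ψ z i) W :=
  (EuclideanSpace.proj i : EuclideanSpace ℝ (Fin n) →L[ℝ] ℝ).contDiff.comp_contDiffOn hψ

theorem fderiv_apply_eq_jacobian (hψ : DifferentiableAt ℝ ψ y) (i a : Fin n) :
    fderiv ℝ ψ y (EuclideanSpace.single a 1) i = jacobian ψ y i a := by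
  have h1 := (EuclideanSpace.proj i : EuclideanSpace ℝ (Fin n) →L[ℝ] ℝ).hasFDerivAt.comp y
    hψ.hasFDerivAt
  simp only [jacobian, Matrix.of_apply, partialDeriv]
  exact (congrArg (fun L => L (EuclideanSpace.single a (1 : ℝ))) h1.fderiv).symm

theorem partialDeriv_comp (hf : DifferentiableAt ℝ f (ψ y)) (hψ : DifferentiableAt ℝ ψ y)
    (a : Fin n) :
    partialDeriv a (fun z => f (ψ z)) y = ∑ i, jacobian ψ y i a * partialDeriv i f (ψ y) := by
  change fderiv ℝ (f ∘ ψ) y _ = _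
  rw [(hf.hasFDerivAt.comp y hψ.hasFDerivAt).fderiv, ContinuousLinearMap.comp_apply, fderiv_eq_sum_partialDeriv]
  simp only [fderiv_apply_eq_jacobian hψ]

theorem partialDeriv_jacobian_comm (hW : IsOpen W) (hψ : ContDiffOn ℝ ∞ ψ W) (hy : y ∈ W)
    (i a b : Fin n) : partialDeriv a (fun z => jacobian ψ z i b) y
      = partialDeriv b (fun z => jacobian ψ z i a) y :=
  partialDeriv_comm hW (contDiffOn_coord hψ i) hy

theorem differentiableAt_jacobian (hW : IsOpen W) (hψ : ContDiffOn ℝ ∞ ψ W) (hy : y ∈ W)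
    (i a : Fin n) : DifferentiableAt ℝ (fun z => jacobian ψ z i a) y :=
  differentiableAt_of_contDiffOn hW (contDiffOn_partialDeriv hW (contDiffOn_coord hψ i) a) hy

/-- Product and chain rule. The two sums with derivatives of the Jacobian are put in the same index
pattern so that they cancel or add up in the combination defining the Christoffel symbols. -/
theorem partialDeriv_transformed_metric (hW : IsOpen W) (hΩ : IsOpen Ω)
    (hψ : ContDiffOn ℝ ∞ ψ W) (hmaps : MapsTo ψ W Ω)
    (hG : ∀ i j, ContDiffOn ℝ ∞ (fun y => G y i j) Ω) (hGs : ∀ z i j, G z i j = G z j i)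
    (hG' : ∀ y ∈ W, ∀ a b, G' y a b
      = ∑ i, ∑ j, jacobian ψ y i a * jacobian ψ y j b * G (ψ y) i j)
    (hy : y ∈ W) (a b c : Fin n) :
    partialDeriv c (fun z => G' z a b) y
      = ∑ i, ∑ j, partialDeriv c (fun z => jacobian ψ z i a) y * jacobian ψ y j b * G (ψ y) i j
      + ∑ i, ∑ j, partialDeriv c (fun z => jacobian ψ z i b) y * jacobian ψ y j a * G (ψ y) i j
      + ∑ i, ∑ j, ∑ l, jacobian ψ y i a * jacobian ψ y j b * jacobian ψ y l c
          * partialDeriv l (fun z => G z i j) (ψ y) := by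
  have dJ : ∀ i a, DifferentiableAt ℝ (fun z => jacobian ψ z i a) y :=
    differentiableAt_jacobian hW hψ hy
  have dψ : DifferentiableAt ℝ ψ y :=
    (hψ.contDiffAt (hW.mem_nhds hy)).differentiableAt (by simp)
  have dG : ∀ i j, DifferentiableAt ℝ (fun z => G z i j) (ψ y) := fun i j =>
    differentiableAt_of_contDiffOn hΩ (hG i j) (hmaps hy)
  have dGψ : ∀ i j, DifferentiableAt ℝ (fun z => G (ψ z) i j) y := fun i j =>
    (dG i j).comp y dψ
  have hterm : ∀ i j, partialDeriv c
      (fun z => jacobian ψ z i a * jacobian ψ z j b * G (ψ z) i j) y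
      = partialDeriv c (fun z => jacobian ψ z i a) y * jacobian ψ y j b * G (ψ y) i j
        + partialDeriv c (fun z => jacobian ψ z j b) y * jacobian ψ y i a * G (ψ y) j i
        + ∑ l, jacobian ψ y i a * jacobian ψ y j b * jacobian ψ y l c
          * partialDeriv l (fun z => G z i j) (ψ y) := by
    intro i j
    rw [partialDeriv_mul ((dJ i a).fun_mul (dJ j b)) (dGψ i j), partialDeriv_mul (dJ i a) (dJ j b),
      partialDeriv_comp (f := fun z => G z i j) (dG i j) dψ, hGs _ j i, Finset.mul_sum]
    simp only [mul_assoc]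
    ring
  rw [partialDeriv_congr (f₂ := fun z => ∑ i, ∑ j,
      jacobian ψ z i a * jacobian ψ z j b * G (ψ z) i j) (by
        filter_upwards [hW.mem_nhds hy] with z hz using hG' z hz a b),
    partialDeriv_sum _ fun i _ => DifferentiableAt.fun_sum fun j _ =>
      ((dJ i a).fun_mul (dJ j b)).fun_mul (dGψ i j)]
  simp only [partialDeriv_sum _ fun j _ => ((dJ _ a).fun_mul (dJ j b)).fun_mul (dGψ _ j), hterm,
    Finset.sum_add_distrib]
  congr 2
  exact Finset.sum_comm

/-- The transformation law is G' = Jᵀ(GJ), so det J divides the unit det G'. -/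
theorem isUnit_det_jacobian (hG' : ∀ a b, G' y a b
      = ∑ i, ∑ j, jacobian ψ y i a * jacobian ψ y j b * G (ψ y) i j)
    (hdet : IsUnit (G' y).det) : IsUnit (jacobian ψ y).det := by
  have : G' y = (jacobian ψ y).transpose * (G (ψ y) * jacobian ψ y) := by
    ext a b
    simp only [hG', Matrix.mul_apply, Matrix.transpose_apply, Finset.mul_sum]
    refine Finset.sum_congr rfl fun i _ => Finset.sum_congr rfl fun j _ => ?_
    ring
  rw [this, Matrix.det_mul, Matrix.det_mul] at hdet
  exact isUnit_of_mul_isUnit_right (isUnit_of_mul_isUnit_right hdet)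

theorem sum_contract_mul (A : Fin n → Fin n → ℝ) (B : Fin n → Fin n → Fin n → ℝ)
    (X : Fin n → ℝ) : ∑ k, (∑ i, ∑ j, A i j * B k i j) * X k
      = ∑ i, ∑ j, A i j * ∑ k, B k i j * X k := by
  simp only [Finset.sum_mul, Finset.mul_sum]
  rw [Finset.sum_comm]
  refine Finset.sum_congr rfl fun i _ => ?_
  rw [Finset.sum_comm]
  refine Finset.sum_congr rfl fun j _ => Finset.sum_congr rfl fun p _ => ?_
  ring

/-- The transformation law of the Christoffel symbols. -/
theorem christoffel_transformed (hW : IsOpen W) (hΩ : IsOpen Ω)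
    (hψ : ContDiffOn ℝ ∞ ψ W) (hmaps : MapsTo ψ W Ω)
    (hG : ∀ i j, ContDiffOn ℝ ∞ (fun y => G y i j) Ω) (hGs : ∀ z i j, G z i j = G z j i)
    (hGs' : ∀ z i j, G' z i j = G' z j i)
    (hG' : ∀ y ∈ W, ∀ a b, G' y a b
      = ∑ i, ∑ j, jacobian ψ y i a * jacobian ψ y j b * G (ψ y) i j)
    (hy : y ∈ W) (hdet : IsUnit (G (ψ y)).det) (hdet' : IsUnit (G' y).det) (a b k : Fin n) :
    ∑ d, christoffel G' d a b y * jacobian ψ y k d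
      = partialDeriv a (fun z => jacobian ψ z k b) y
        + ∑ i, ∑ j, jacobian ψ y i a * jacobian ψ y j b * christoffel G k i j (ψ y) := by
  -- Contracting the free index with the invertible matrix GJ lowers it, which reduces the law to
  -- Christoffel symbols of the first kind, free of inverse metrics.
  have hunit : IsUnit (G (ψ y) * jacobian ψ y) := by
    rw [Matrix.isUnit_iff_isUnit_det, Matrix.det_mul]
    exact hdet.mul (isUnit_det_jacobian (hG' y hy) hdet')
  have hL : ∀ c, ∑ k, (∑ d, christoffel G' d a b y * jacobian ψ y k d)
        * ∑ m, G (ψ y) k m * jacobian ψ y m c = ∑ d, christoffel G' d a b y * G' y d c := by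
    intro c
    simp only [hG' y hy, Finset.mul_sum, Finset.sum_mul]
    rw [Finset.sum_comm]
    refine (Finset.sum_congr rfl fun m _ => Finset.sum_comm).trans ?_
    rw [Finset.sum_comm]
    refine Finset.sum_congr rfl fun d _ => ?_
    rw [Finset.sum_comm]
    refine Finset.sum_congr rfl fun k _ => Finset.sum_congr rfl fun m _ => ?_
    ring
  have hR : ∀ c, ∑ k, (∑ i, ∑ j, jacobian ψ y i a * jacobian ψ y j b * christoffel G k i j (ψ y))
        * ∑ m, G (ψ y) k m * jacobian ψ y m c
      = ∑ i, ∑ j, ∑ m, jacobian ψ y i a * jacobian ψ y j b * jacobian ψ y m c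
        * ∑ k, christoffel G k i j (ψ y) * G (ψ y) k m := by
    intro c
    rw [sum_contract_mul]
    refine Finset.sum_congr rfl fun i _ => Finset.sum_congr rfl fun j _ => ?_
    simp only [Finset.mul_sum]
    rw [Finset.sum_comm]
    refine Finset.sum_congr rfl fun m _ => Finset.sum_congr rfl fun k _ => ?_
    ring
  refine congrFun (Matrix.vecMul_injective_of_isUnit hunit (funext fun c => ?_)
    : (fun k => ∑ d, christoffel G' d a b y * jacobian ψ y k d)
      = fun k => partialDeriv a (fun z => jacobian ψ z k b) y
        + ∑ i, ∑ j, jacobian ψ y i a * jacobian ψ y j b * christoffel G k i j (ψ y)) k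
  simp only [Matrix.vecMul, dotProduct, Matrix.mul_apply, add_mul, Finset.sum_add_distrib]
  rw [hL, hR, sum_christoffel_mul hGs' hdet']
  simp only [sum_christoffel_mul hGs hdet,
    partialDeriv_transformed_metric hW hΩ hψ hmaps hG hGs hG' hy]
  have e1 : ∑ i, ∑ j, ∑ l, jacobian ψ y i b * jacobian ψ y j c * jacobian ψ y l a
          * partialDeriv l (fun z => G z i j) (ψ y)
      = ∑ i, ∑ j, ∑ l, jacobian ψ y i a * jacobian ψ y j b * jacobian ψ y l c
          * partialDeriv i (fun z => G z j l) (ψ y) := by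
    rw [(Finset.sum_congr rfl fun i _ => Finset.sum_comm :
      ∑ i, ∑ j, ∑ l, jacobian ψ y i b * jacobian ψ y j c * jacobian ψ y l a
          * partialDeriv l (fun z => G z i j) (ψ y) = _), Finset.sum_comm]
    refine Finset.sum_congr rfl fun i _ => Finset.sum_congr rfl fun j _ =>
      Finset.sum_congr rfl fun l _ => ?_
    ring
  have e2 : ∑ i, ∑ j, ∑ l, jacobian ψ y i a * jacobian ψ y j c * jacobian ψ y l b
          * partialDeriv l (fun z => G z i j) (ψ y)
      = ∑ i, ∑ j, ∑ l, jacobian ψ y i a * jacobian ψ y j b * jacobian ψ y l c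
          * partialDeriv j (fun z => G z i l) (ψ y) := by
    refine Finset.sum_congr rfl fun i _ => ?_
    rw [Finset.sum_comm]
    refine Finset.sum_congr rfl fun j _ => Finset.sum_congr rfl fun l _ => ?_
    ring
  have e3 : ∑ k, partialDeriv a (fun z => jacobian ψ z k b) y * ∑ m, G (ψ y) k m * jacobian ψ y m c
      = ∑ i, ∑ j, partialDeriv a (fun z => jacobian ψ z i b) y * jacobian ψ y j c
          * G (ψ y) i j := by
    simp only [Finset.mul_sum]
    refine Finset.sum_congr rfl fun i _ => Finset.sum_congr rfl fun j _ => ?_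
    ring
  have e4 : ∑ i, ∑ j, ∑ m, jacobian ψ y i a * jacobian ψ y j b * jacobian ψ y m c *
        (1 / 2 * (partialDeriv i (fun z => G z j m) (ψ y) + partialDeriv j (fun z => G z i m) (ψ y)
          - partialDeriv m (fun z => G z i j) (ψ y)))
      = 1 / 2 * (∑ i, ∑ j, ∑ l, jacobian ψ y i a * jacobian ψ y j b * jacobian ψ y l c
          * partialDeriv i (fun z => G z j l) (ψ y)
        + ∑ i, ∑ j, ∑ l, jacobian ψ y i a * jacobian ψ y j b * jacobian ψ y l c
          * partialDeriv j (fun z => G z i l) (ψ y)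
        - ∑ i, ∑ j, ∑ l, jacobian ψ y i a * jacobian ψ y j b * jacobian ψ y l c
          * partialDeriv l (fun z => G z i j) (ψ y)) := by
    simp only [← Finset.sum_add_distrib, ← Finset.sum_sub_distrib, Finset.mul_sum]
    refine Finset.sum_congr rfl fun i _ => Finset.sum_congr rfl fun j _ =>
      Finset.sum_congr rfl fun l _ => ?_
    ring
  rw [e1, e2, e3, e4]
  -- By symmetry of the second derivatives of ψ, the terms differentiated in a, c and in b, c
  -- cancel; the two equal terms in a, b absorb the factor 1/2.
  simp only [partialDeriv_jacobian_comm hW hψ hy _ b a, partialDeriv_jacobian_comm hW hψ hy _ c _]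
  ring

/-- The Hessian transforms as a tensor. -/
theorem hessian_transformed (hW : IsOpen W) (hΩ : IsOpen Ω)
    (hψ : ContDiffOn ℝ ∞ ψ W) (hmaps : MapsTo ψ W Ω)
    (hG : ∀ i j, ContDiffOn ℝ ∞ (fun y => G y i j) Ω) (hGs : ∀ z i j, G z i j = G z j i)
    (hGs' : ∀ z i j, G' z i j = G' z j i)
    (hG' : ∀ y ∈ W, ∀ a b, G' y a b
      = ∑ i, ∑ j, jacobian ψ y i a * jacobian ψ y j b * G (ψ y) i j)
    (hf : ContDiffOn ℝ ∞ f Ω)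
    (hy : y ∈ W) (hdet : IsUnit (G (ψ y)).det) (hdet' : IsUnit (G' y).det) (a b : Fin n) :
    hessian G' (fun z => f (ψ z)) y a b
      = ∑ i, ∑ j, jacobian ψ y i a * jacobian ψ y j b * hessian G f (ψ y) i j := by
  have dJ : ∀ i a, DifferentiableAt ℝ (fun z => jacobian ψ z i a) y :=
    differentiableAt_jacobian hW hψ hy
  have dψ : ∀ z ∈ W, DifferentiableAt ℝ ψ z := fun z hz =>
    (hψ.contDiffAt (hW.mem_nhds hz)).differentiableAt (by simp)
  have df : ∀ i, DifferentiableAt ℝ (partialDeriv i f) (ψ y) := fun i =>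
    differentiableAt_of_contDiffOn hΩ (contDiffOn_partialDeriv hΩ hf i) (hmaps hy)
  have dfψ : ∀ i, DifferentiableAt ℝ (fun z => partialDeriv i f (ψ z)) y := fun i =>
    (df i).comp y (dψ y hy)
  have h1 : ∀ z ∈ W, ∀ b, partialDeriv b (fun z => f (ψ z)) z
      = ∑ i, jacobian ψ z i b * partialDeriv i f (ψ z) := fun z hz b =>
    partialDeriv_comp (differentiableAt_of_contDiffOn hΩ hf (hmaps hz)) (dψ z hz) b
  have h2 : partialDeriv a (partialDeriv b fun z => f (ψ z)) y
      = ∑ i, partialDeriv a (fun z => jacobian ψ z i b) y * partialDeriv i f (ψ y)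
      + ∑ i, ∑ j, jacobian ψ y i a * jacobian ψ y j b
          * partialDeriv i (partialDeriv j f) (ψ y) := by
    rw [partialDeriv_congr (f₂ := fun z => ∑ i, jacobian ψ z i b * partialDeriv i f (ψ z)) (by
        filter_upwards [hW.mem_nhds hy] with z hz using h1 z hz b),
      partialDeriv_sum _ fun i _ => (dJ i b).fun_mul (dfψ i)]
    simp only [partialDeriv_mul (dJ _ b) (dfψ _), partialDeriv_comp (df _) (dψ y hy),
      Finset.sum_add_distrib, Finset.mul_sum]
    rw [add_comm, Finset.sum_comm]
    congr 1
    refine Finset.sum_congr rfl fun i _ => Finset.sum_congr rfl fun j _ => ?_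
    ring
  have h3 : ∑ d, christoffel G' d a b y * partialDeriv d (fun z => f (ψ z)) y
      = ∑ k, (∑ d, christoffel G' d a b y * jacobian ψ y k d) * partialDeriv k f (ψ y) := by
    simp only [h1 y hy, Finset.mul_sum, Finset.sum_mul]
    rw [Finset.sum_comm]
    simp only [mul_assoc]
  simp only [hessian, Matrix.of_apply]
  rw [h2, h3]
  -- The inhomogeneous term of the Christoffel law cancels the second derivatives of ψ coming from
  -- the chain rule.
  simp only [christoffel_transformed hW hΩ hψ hmaps hG hGs hGs' hG' hy hdet hdet', add_mul, mul_sub,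
    Finset.sum_add_distrib, Finset.sum_sub_distrib]
  have h4 : ∑ k, (∑ i, ∑ j, jacobian ψ y i a * jacobian ψ y j b * christoffel G k i j (ψ y))
        * partialDeriv k f (ψ y)
      = ∑ i, ∑ j, jacobian ψ y i a * jacobian ψ y j b
        * ∑ p, christoffel G p i j (ψ y) * partialDeriv p f (ψ y) :=
    sum_contract_mul _ _ _
  rw [h4]
  ring

end ChangeOfCoordinates

end CottonGravity

namespace CottonGravity

/-! ### Components of tensor fields in charts -/

section Charts

open Filter Topology Bundle

variable {n : ℕ} {M : Type*} [TopologicalSpace M] [ChartedSpace (EuclideanSpace ℝ (Fin n)) M]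
  [IsManifold (𝓡 n) ∞ M] {e e' : OpenPartialHomeomorph M (EuclideanSpace ℝ (Fin n))}

theorem contMDiffOn_chart_symm' (he : e ∈ atlas (EuclideanSpace ℝ (Fin n)) M) :
    ContMDiffOn (𝓡 n) (𝓡 n) ∞ e.symm e.target :=
  contMDiffOn_symm_of_mem_maximalAtlas (IsManifold.subset_maximalAtlas he)

theorem contMDiffOn_chart' (he : e ∈ atlas (EuclideanSpace ℝ (Fin n)) M) :
    ContMDiffOn (𝓡 n) (𝓡 n) ∞ e e.source :=
  contMDiffOn_of_mem_maximalAtlas (IsManifold.subset_maximalAtlas he)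

/-- The coordinate field is the tangent map of the smooth map `e.symm` applied to a constant
section. -/
theorem contMDiffOn_coordVec (he : e ∈ atlas (EuclideanSpace ℝ (Fin n)) M) (i : Fin n) :
    ContMDiffOn (𝓡 n) ((𝓡 n).prod 𝓘(ℝ, EuclideanSpace ℝ (Fin n))) ∞
      (fun y => TotalSpace.mk' (EuclideanSpace ℝ (Fin n))
        (E := fun x : M => TangentSpace (𝓡 n) x) (e.symm y) (coordVec e i y)) e.target := by
  have h1 := (contMDiffOn_chart_symm' he).contMDiffOn_tangentMapWithin (m := ∞) (by simp)
    e.open_target.uniqueMDiffOn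
  have h2 : ContMDiff (𝓡 n) ((𝓡 n).prod 𝓘(ℝ, EuclideanSpace ℝ (Fin n))) ∞
      (fun y => (⟨y, EuclideanSpace.single i (1 : ℝ)⟩ :
        TangentBundle (𝓡 n) (EuclideanSpace ℝ (Fin n)))) :=
    contMDiff_vectorSpace_iff_contDiff.2 contDiff_const
  refine (h1.comp h2.contMDiffOn fun y hy => hy).congr fun y hy => ?_
  simp only [Function.comp, tangentMapWithin, coordVec]
  rw [mfderivWithin_of_isOpen e.open_target hy]

theorem contDiffOn_comp (h : SymTensorField n M) (he : e ∈ atlas (EuclideanSpace ℝ (Fin n)) M)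
    (i j : Fin n) : ContDiffOn ℝ ∞ (fun y => h.comp e y i j) e.target := by
  have h1 : ContMDiffOn (𝓡 n) ((𝓡 n).prod 𝓘(ℝ)) ∞
      (fun y => TotalSpace.mk' ℝ (E := Bundle.Trivial M ℝ) (e.symm y)
        (h.val (e.symm y) (coordVec e i y) (coordVec e j y))) e.target := by
    apply ContMDiffOn.clm_bundle_apply₂ (F₁ := EuclideanSpace ℝ (Fin n))
      (F₂ := EuclideanSpace ℝ (Fin n))
    · exact h.contMDiff.comp_contMDiffOn (contMDiffOn_chart_symm' he)
    · exact contMDiffOn_coordVec he i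
    · exact contMDiffOn_coordVec he j
  refine contMDiffOn_iff_contDiffOn.1 fun y hy => ?_
  have := h1 y hy
  simp only [contMDiffWithinAt_totalSpace] at this
  exact this.2

theorem comp_symm (h : SymTensorField n M) (y : EuclideanSpace ℝ (Fin n)) (i j : Fin n) :
    h.comp e y i j = h.comp e y j i :=
  h.symm _ _ _

theorem contDiffOn_transition (he : e ∈ atlas (EuclideanSpace ℝ (Fin n)) M)
    (he' : e' ∈ atlas (EuclideanSpace ℝ (Fin n)) M) :
    ContDiffOn ℝ ∞ (e ∘ e'.symm) (e'.symm.trans e).source :=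
  contMDiffOn_iff_contDiffOn.1 <| (contMDiffOn_chart' he).comp
    ((contMDiffOn_chart_symm' he').mono fun _ hy => ((e'.symm.trans_source e) ▸ hy).1)
    fun _ hy => ((e'.symm.trans_source e) ▸ hy).2

/-- The chain rule for e'.symm = e.symm ∘ (e ∘ e'.symm) near y. Both sides are read in the model
space because the two tangent spaces sit over base points that are equal only propositionally. -/
theorem coordVec_transition (he : e ∈ atlas (EuclideanSpace ℝ (Fin n)) M)
    (he' : e' ∈ atlas (EuclideanSpace ℝ (Fin n)) M) {y : EuclideanSpace ℝ (Fin n)}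
    (hy : y ∈ e'.target) (hy' : e'.symm y ∈ e.source) (a : Fin n) :
    (coordVec e' a y : EuclideanSpace ℝ (Fin n))
      = ∑ i, jacobian (e ∘ e'.symm) y i a
        • (coordVec e i (e (e'.symm y)) : EuclideanSpace ℝ (Fin n)) := by
  have hyW : y ∈ (e'.symm.trans e).source := by simp [hy, hy']
  have hψ : DifferentiableAt ℝ (e ∘ e'.symm) y :=
    ((contDiffOn_transition he he').contDiffAt
      ((e'.symm.trans e).open_source.mem_nhds hyW)).differentiableAt (by simp)
  have hs : MDifferentiableAt (𝓡 n) (𝓡 n) e.symm ((e ∘ e'.symm) y) :=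
    ((contMDiffOn_chart_symm' he).contMDiffAt
      (e.open_target.mem_nhds (e.map_source hy'))).mdifferentiableAt (by simp)
  have hcomp := mfderiv_comp y hs hψ.mdifferentiableAt
  have heq : e'.symm =ᶠ[𝓝 y] e.symm ∘ (e ∘ e'.symm) := by
    filter_upwards [(e'.symm.trans e).open_source.mem_nhds hyW] with z hz
    rw [e'.symm.trans_source e] at hz
    exact (e.left_inv hz.2).symm
  rw [← heq.mfderiv_eq, mfderiv_eq_fderiv] at hcomp
  let L : EuclideanSpace ℝ (Fin n) →L[ℝ] EuclideanSpace ℝ (Fin n) :=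
    mfderiv (𝓡 n) (𝓡 n) e.symm (e (e'.symm y))
  have h1 : (coordVec e' a y : EuclideanSpace ℝ (Fin n)) = L (fderiv ℝ (e ∘ e'.symm) y (EuclideanSpace.single a 1)) :=
    congrArg (fun L : EuclideanSpace ℝ (Fin n) →L[ℝ] EuclideanSpace ℝ (Fin n) =>
      L (EuclideanSpace.single a (1 : ℝ))) hcomp
  rw [h1, ← sum_smul_single (fderiv ℝ (e ∘ e'.symm) y (EuclideanSpace.single a 1)), map_sum]
  refine Finset.sum_congr rfl fun i _ => ?_
  rw [fderiv_apply_eq_jacobian hψ, map_smul]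
  rfl

theorem comp_transition (h : SymTensorField n M) (he : e ∈ atlas (EuclideanSpace ℝ (Fin n)) M)
    (he' : e' ∈ atlas (EuclideanSpace ℝ (Fin n)) M) {y : EuclideanSpace ℝ (Fin n)}
    (hy : y ∈ e'.target) (hy' : e'.symm y ∈ e.source) (a b : Fin n) :
    h.comp e' y a b = ∑ i, ∑ j, jacobian (e ∘ e'.symm) y i a * jacobian (e ∘ e'.symm) y j b
      * h.comp e ((e ∘ e'.symm) y) i j := by
  let V : M → EuclideanSpace ℝ (Fin n) →L[ℝ] EuclideanSpace ℝ (Fin n) →L[ℝ] ℝ := h.val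
  have h1 : ∀ (e : OpenPartialHomeomorph M (EuclideanSpace ℝ (Fin n))) z i j,
      h.comp e z i j = V (e.symm z) (coordVec e i z) (coordVec e j z) := fun _ _ _ _ => rfl
  have h2 : ∀ (B : EuclideanSpace ℝ (Fin n) →L[ℝ] EuclideanSpace ℝ (Fin n) →L[ℝ] ℝ)
      (J : Matrix (Fin n) (Fin n) ℝ) (c : Fin n → EuclideanSpace ℝ (Fin n)),
      B (∑ i, J i a • c i) (∑ j, J j b • c j) = ∑ i, ∑ j, J i a * J j b * B (c i) (c j) := by
    intro B J c
    simp only [map_sum, map_smul, sum_apply, smul_apply, smul_eq_mul, Finset.mul_sum]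
    rw [Finset.sum_comm]
    refine Finset.sum_congr rfl fun i _ => Finset.sum_congr rfl fun j _ => ?_
    ring
  rw [h1, coordVec_transition he he' hy hy', coordVec_transition he he' hy hy']
  refine (h2 _ (jacobian (e ∘ e'.symm) y) fun i => coordVec e i (e (e'.symm y))).trans ?_
  simp only [h1, Function.comp, e.left_inv hy']

/-- A kernel vector of the component matrix gives a tangent vector orthogonal to everything. Its
coefficients in a Lorentz-orthonormal basis are, up to sign, its products with the basis vectors, so
it is zero; the differential of the chart is injective. -/
theorem isUnit_det_comp (g : LorentzMetric n M) (he : e ∈ atlas (EuclideanSpace ℝ (Fin n)) M)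
    {y : EuclideanSpace ℝ (Fin n)} (hy : y ∈ e.target) : IsUnit (g.comp e y).det := by
  rw [isUnit_iff_ne_zero]
  intro h0
  obtain ⟨v, hv, hGv⟩ := Matrix.exists_mulVec_eq_zero_iff.2 h0
  have hbij : Function.Bijective (mfderiv (𝓡 n) (𝓡 n) e.symm y) :=
    (mdifferentiable_of_mem_atlas (I := 𝓡 n) he).symm.mfderiv_bijective hy
  let D : EuclideanSpace ℝ (Fin n) →L[ℝ] TangentSpace (𝓡 n) (e.symm y) :=
    mfderiv (𝓡 n) (𝓡 n) e.symm y
  have hD : Function.Bijective D := hbij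
  have hg : ∀ w z : EuclideanSpace ℝ (Fin n), g.val (e.symm y) (D w) (D z)
      = ∑ i, w i * ∑ j, g.comp e y i j * z j := by
    intro w z
    have hDs : ∀ u : EuclideanSpace ℝ (Fin n), D u = ∑ i, u i • coordVec e i y := by
      intro u
      conv_lhs => rw [← sum_smul_single u]
      rw [map_sum]
      exact Finset.sum_congr rfl fun i _ => map_smul D _ _
    rw [hDs w, hDs z]
    simp only [map_sum, map_smul, sum_apply, smul_apply, smul_eq_mul, Finset.mul_sum]
    rw [Finset.sum_comm]
    refine Finset.sum_congr rfl fun i _ => Finset.sum_congr rfl fun j _ => ?_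
    simp only [SymTensorField.comp, Matrix.of_apply]
    ring
  set X : EuclideanSpace ℝ (Fin n) := WithLp.toLp 2 v
  have hX : ∀ z, g.val (e.symm y) z (D X) = 0 := by
    intro z
    obtain ⟨w, rfl⟩ := hD.2 z
    rw [hg]
    refine Finset.sum_eq_zero fun i _ => ?_
    have : ∑ j, g.comp e y i j * X j = 0 := congrFun hGv i
    rw [this, mul_zero]
  obtain ⟨b, hb⟩ := g.lorentzian (e.symm y)
  have hrepr : b.repr (D X) = 0 := by
    ext k
    have h1 := hX (b k)
    rw [← b.sum_repr (D X), map_sum] at h1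
    simp only [map_smul, hb, smul_eq_mul, mul_ite, mul_zero, Finset.sum_ite_eq,
      Finset.mem_univ, if_true] at h1
    by_cases hk : (k : ℕ) = 0
    · simpa [hk] using h1
    · simpa [hk] using h1
  have hDX : D X = 0 := by simpa using hrepr
  have hX0 : X = 0 := hD.1 (hDX.trans (map_zero D).symm)
  apply hv
  have := congrArg WithLp.ofLp hX0
  simpa [X] using this

end Charts

end CottonGravity

namespace CottonGravity

/-! ### Codazzi tensors on spaces of constant curvature -/

section Ferus

open Filter Topology

variable {n : ℕ} {M : Type*} [TopologicalSpace M] [ChartedSpace (EuclideanSpace ℝ (Fin n)) M]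
  [IsManifold (𝓡 n) ∞ M] {e e' : OpenPartialHomeomorph M (EuclideanSpace ℝ (Fin n))}

/-- Smooth symmetric covariant tensors of order two, given by their components in all charts. -/
structure IsTensorFamily
    (c : OpenPartialHomeomorph M (EuclideanSpace ℝ (Fin n)) →
      EuclideanSpace ℝ (Fin n) → Matrix (Fin n) (Fin n) ℝ) : Prop where
  smooth : ∀ e ∈ atlas (EuclideanSpace ℝ (Fin n)) M, ∀ i j,
    ContDiffOn ℝ ∞ (fun y => c e y i j) e.target
  symm : ∀ e y i j, c e y i j = c e y j i
  transition : ∀ e ∈ atlas (EuclideanSpace ℝ (Fin n)) M,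
    ∀ e' ∈ atlas (EuclideanSpace ℝ (Fin n)) M, ∀ y ∈ e'.target, e'.symm y ∈ e.source → ∀ a b,
      c e' y a b = ∑ i, ∑ j, jacobian (e ∘ e'.symm) y i a * jacobian (e ∘ e'.symm) y j b
        * c e ((e ∘ e'.symm) y) i j

/-- Component families are the common setting for C and for (tr T) g/(n-1) - T, which is only ever
given by components. -/
theorem SymTensorField.isTensorFamily (h : SymTensorField n M) : IsTensorFamily h.comp where
  smooth _ he := contDiffOn_comp h he
  symm _ := comp_symm h
  transition _ he _ he' _ hy hy' := comp_transition h he he' hy hy'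

/-- The equation `c = ∇∇φ + κ φ g` at the point `y` of the chart `e`. -/
def HasFormAt (g : LorentzMetric n M)
    (c : OpenPartialHomeomorph M (EuclideanSpace ℝ (Fin n)) →
      EuclideanSpace ℝ (Fin n) → Matrix (Fin n) (Fin n) ℝ) (κ : ℝ) (φ : M → ℝ)
    (e : OpenPartialHomeomorph M (EuclideanSpace ℝ (Fin n))) (y : EuclideanSpace ℝ (Fin n)) :
    Prop :=
  ∀ j k : Fin n, c e y j k
    = hessian (g.comp e) (φ ∘ e.symm) y j k + κ * (φ ∘ e.symm) y * g.comp e y j k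

theorem hessian_congr {G : EuclideanSpace ℝ (Fin n) → Matrix (Fin n) (Fin n) ℝ}
    {f₁ f₂ : EuclideanSpace ℝ (Fin n) → ℝ} {y : EuclideanSpace ℝ (Fin n)} (h : f₁ =ᶠ[𝓝 y] f₂)
    (j k : Fin n) : hessian G f₁ y j k = hessian G f₂ y j k := by
  simp only [hessian, Matrix.of_apply]
  have h1 : ∀ i, partialDeriv i f₁ =ᶠ[𝓝 y] partialDeriv i f₂ := fun i =>
    h.eventuallyEq_nhds.mono fun z hz => partialDeriv_congr hz
  rw [partialDeriv_congr (h1 k)]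
  simp only [(h1 _).self_of_nhds]

theorem contDiffOn_in_chart (he : e ∈ atlas (EuclideanSpace ℝ (Fin n)) M) {φ : M → ℝ} {V : Set M}
    (hφ : ContMDiffOn (𝓡 n) 𝓘(ℝ, ℝ) ∞ φ V) :
    ContDiffOn ℝ ∞ (φ ∘ e.symm) (e.target ∩ e.symm ⁻¹' V) :=
  contMDiffOn_iff_contDiffOn.1 <|
    hφ.comp ((contMDiffOn_chart_symm' he).mono inter_subset_left) inter_subset_right

variable {g : LorentzMetric n M}
  {c : OpenPartialHomeomorph M (EuclideanSpace ℝ (Fin n)) →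
      EuclideanSpace ℝ (Fin n) → Matrix (Fin n) (Fin n) ℝ} {κ : ℝ} {φ φ' : M → ℝ} {V : Set M}

theorem HasFormAt.congr {y : EuclideanSpace ℝ (Fin n)} (hy : y ∈ e.target)
    (h : HasFormAt g c κ φ e y) (hφ : φ' =ᶠ[𝓝 (e.symm y)] φ) : HasFormAt g c κ φ' e y := by
  have h1 : φ' ∘ e.symm =ᶠ[𝓝 y] φ ∘ e.symm :=
    (e.continuousAt_symm hy).eventually hφ
  intro j k
  rw [hessian_congr h1, h1.self_of_nhds]
  exact h j k

/-- The equation `c = ∇∇φ + κ φ g` does not depend on the chart. -/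
theorem HasFormAt.transition (hc : IsTensorFamily c)
    (he : e ∈ atlas (EuclideanSpace ℝ (Fin n)) M) (he' : e' ∈ atlas (EuclideanSpace ℝ (Fin n)) M)
    (hV : IsOpen V) (hφ : ContMDiffOn (𝓡 n) 𝓘(ℝ, ℝ) ∞ φ V) {x : M} (hxV : x ∈ V)
    (hx : x ∈ e.source) (hx' : x ∈ e'.source) (h : HasFormAt g c κ φ e (e x)) :
    HasFormAt g c κ φ e' (e' x) := by
  set W := e'.target ∩ e'.symm ⁻¹' (e.source ∩ V)
  have hW : IsOpen W := e'.isOpen_inter_preimage_symm (e.open_source.inter hV)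
  set Ω := e.target ∩ e.symm ⁻¹' V
  have hΩ : IsOpen Ω := e.isOpen_inter_preimage_symm hV
  have hsub : W ⊆ (e'.symm.trans e).source := by
    rw [e'.symm.trans_source e]
    exact fun y hy => ⟨hy.1, hy.2.1⟩
  have hmaps : MapsTo (e ∘ e'.symm) W Ω := fun y hy =>
    ⟨e.map_source hy.2.1, by simpa [e.left_inv hy.2.1] using hy.2.2⟩
  have hy : e' x ∈ W := ⟨e'.map_source hx', by simp [e'.left_inv hx', hx, hxV]⟩
  have hψ : (e ∘ e'.symm) (e' x) = e x := by simp [e'.left_inv hx']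
  have hhess := hessian_transformed (G := g.comp e) (G' := g.comp e') (f := φ ∘ e.symm) hW hΩ
    ((contDiffOn_transition he he').mono hsub) hmaps
    (fun i j => (contDiffOn_comp _ he i j).mono inter_subset_left)
    (comp_symm _) (comp_symm _)
    (fun y hy a b => comp_transition _ he he' hy.1 hy.2.1 a b)
    (contDiffOn_in_chart he hφ) hy (isUnit_det_comp g he (hmaps hy).1) (isUnit_det_comp g he' hy.1)
  have hcongr : φ ∘ e'.symm =ᶠ[𝓝 (e' x)] fun z => (φ ∘ e.symm) ((e ∘ e'.symm) z) := by
    filter_upwards [hW.mem_nhds hy] with z hz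
    simp [e.left_inv hz.2.1]
  intro a b
  rw [hessian_congr hcongr, hhess, hc.transition e he e' he' _ hy.1 hy.2.1,
    comp_transition _ he he' hy.1 hy.2.1]
  rw [hψ]
  have hφx : (φ ∘ e'.symm) (e' x) = (φ ∘ e.symm) (e x) := by
    simp [e.left_inv hx, e'.left_inv hx']
  rw [hφx]
  simp only [h _ _, Finset.mul_sum, ← Finset.sum_add_distrib]
  refine Finset.sum_congr rfl fun i _ => Finset.sum_congr rfl fun j _ => ?_
  ring

/-- Constant curvature in all charts, in terms of `κ`. -/
def HasSectionalCurvature (g : LorentzMetric n M) (κ : ℝ) : Prop :=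
  ∀ e ∈ atlas (EuclideanSpace ℝ (Fin n)) M, ∀ y ∈ e.target, ∀ j k l m : Fin n,
    riemann (g.comp e) j k l m y =
      κ * (g.comp e y j l * g.comp e y k m - g.comp e y j m * g.comp e y k l)

/-- The Codazzi equation in all charts. -/
def IsCodazziFamily (g : LorentzMetric n M)
    (c : OpenPartialHomeomorph M (EuclideanSpace ℝ (Fin n)) →
      EuclideanSpace ℝ (Fin n) → Matrix (Fin n) (Fin n) ℝ) : Prop :=
  ∀ e ∈ atlas (EuclideanSpace ℝ (Fin n)) M, ∀ y ∈ e.target, ∀ i j k : Fin n,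
    covDeriv (g.comp e) (c e) i j k y = covDeriv (g.comp e) (c e) j i k y

/-- The equation `c = ∇∇φ + κ φ g` at all points of `U`, in all charts. -/
def HasFormOn (g : LorentzMetric n M)
    (c : OpenPartialHomeomorph M (EuclideanSpace ℝ (Fin n)) →
      EuclideanSpace ℝ (Fin n) → Matrix (Fin n) (Fin n) ℝ) (κ : ℝ) (φ : M → ℝ) (U : Set M) : Prop :=
  ∀ e ∈ atlas (EuclideanSpace ℝ (Fin n)) M, ∀ y ∈ e.target, e.symm y ∈ U → HasFormAt g c κ φ e y

theorem isCodazziFamily_of_form (hc : IsTensorFamily c) (hg : HasSectionalCurvature g κ)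
    (h : ∀ p : M, ∃ U : Set M, IsOpen U ∧ p ∈ U ∧ ∃ φ : M → ℝ,
      ContMDiffOn (𝓡 n) 𝓘(ℝ, ℝ) ∞ φ U ∧ HasFormOn g c κ φ U) : IsCodazziFamily g c := by
  intro e he y hy i j k
  obtain ⟨U, hU, hyU, φ, hφ, hform⟩ := h (e.symm y)
  exact codazzi_of_form (W := e.target ∩ e.symm ⁻¹' U) (κ := κ) (f := φ ∘ e.symm)
    (e.isOpen_inter_preimage_symm hU)
    (fun i j => (contDiffOn_comp _ he i j).mono inter_subset_left)
    (fun i j => (hc.smooth e he i j).mono inter_subset_left)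
    (fun z hz => isUnit_det_comp g he hz.1) (comp_symm _) (fun z hz => hg e he z hz.1)
    (contDiffOn_in_chart he hφ) (fun z hz => hform e he z hz.1 hz.2) ⟨hy, hyU⟩ i j k

/-- Around each point the solutions of `c = ∇∇φ + κ φ g`, for a Codazzi tensor `c` on a space of
constant curvature, form a family parametrized by their value and first derivatives, and each germ
of a solution belongs to exactly one member of the family. -/
theorem exists_local_family (hc : IsTensorFamily c) (hg : HasSectionalCurvature g κ)
    (hcod : IsCodazziFamily g c) (p : M) :
    ∃ U : Set M, IsOpen U ∧ p ∈ U ∧ ∃ φ : ℝ × (Fin n → ℝ) → M → ℝ,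
      (∀ a, ContMDiffOn (𝓡 n) 𝓘(ℝ, ℝ) ∞ (φ a) U ∧ HasFormOn g c κ (φ a) U) ∧
      ∀ x ∈ U, ∀ (V : Set M) (ψ : M → ℝ), IsOpen V → x ∈ V →
        ContMDiffOn (𝓡 n) 𝓘(ℝ, ℝ) ∞ ψ V → HasFormOn g c κ ψ V → ∃! a, ψ =ᶠ[𝓝 x] φ a := by
  set e := chartAt (EuclideanSpace ℝ (Fin n)) p
  have he : e ∈ atlas (EuclideanSpace ℝ (Fin n)) M := chart_mem_atlas _ p
  have hpe : p ∈ e.source := mem_chart_source _ p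
  have sG := contDiffOn_comp g.toSymTensorField he
  have hdet : ∀ y ∈ e.target, IsUnit (g.comp e y).det := fun y hy => isUnit_det_comp g he hy
  obtain ⟨r, hr, hsub, hsol⟩ := exists_ball_forall_exists_form e.open_target sG (hc.smooth e he)
    hdet (comp_symm _) (hc.symm e) (hg e he) (hcod e he) (e.map_source hpe)
  set B := Metric.ball (e p) r
  have hB : IsOpen B := Metric.isOpen_ball
  have hpB : e p ∈ B := Metric.mem_ball_self hr
  have uniq : ∀ {B' : Set (EuclideanSpace ℝ (Fin n))} {f₁ f₂ : EuclideanSpace ℝ (Fin n) → ℝ}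
      {y : EuclideanSpace ℝ (Fin n)}, IsOpen B' → Convex ℝ B' → B' ⊆ e.target →
      ContDiffOn ℝ ∞ f₁ B' → ContDiffOn ℝ ∞ f₂ B' →
      (∀ y ∈ B', ∀ j k, c e y j k = hessian (g.comp e) f₁ y j k + κ * f₁ y * g.comp e y j k) →
      (∀ y ∈ B', ∀ j k, c e y j k = hessian (g.comp e) f₂ y j k + κ * f₂ y * g.comp e y j k) →
      y ∈ B' → f₁ y = f₂ y → (∀ i, partialDeriv i f₁ y = partialDeriv i f₂ y) → EqOn f₁ f₂ B' :=
    fun hB' hconv hsub' h₁ h₂ hf₁ hf₂ hy h0 h1 => eqOn_of_form hB' hconv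
      (fun i j => (sG i j).mono hsub') (fun i j => (hc.smooth e he i j).mono hsub')
      (fun y hy => hdet y (hsub' hy)) h₁ h₂ hf₁ hf₂ hy h0 h1
  -- The family: `f a` is the solution on B whose jet at the centre `e p` is a.
  choose f hfs hf0 hf1 hform using fun a : ℝ × (Fin n → ℝ) => hsol (e p) hpB a.1 a.2
  have hfe : ∀ a, ∀ y ∈ e.target, (f a ∘ e) ∘ e.symm =ᶠ[𝓝 y] f a := by
    intro a y hy
    filter_upwards [e.open_target.mem_nhds hy] with z hz
    simp [e.right_inv hz]
  set U := e.source ∩ e ⁻¹' B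
  have hU : IsOpen U := e.isOpen_inter_preimage hB
  have hsm : ∀ a, ContMDiffOn (𝓡 n) 𝓘(ℝ, ℝ) ∞ (f a ∘ e) U := fun a =>
    (contMDiffOn_iff_contDiffOn.2 (hfs a)).comp ((contMDiffOn_chart' he).mono inter_subset_left)
      inter_subset_right
  refine ⟨U, hU, ⟨hpe, hpB⟩, fun a => f a ∘ e, fun a => ⟨hsm a, ?_⟩, ?_⟩
  · intro e' he' y hy hyU
    have h1 : HasFormAt g c κ (f a ∘ e) e (e (e'.symm y)) := by
      intro j k
      have h2 := hfe a _ (e.map_source hyU.1)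
      rw [hessian_congr h2, h2.self_of_nhds]
      exact hform a _ hyU.2 j k
    have := h1.transition hc he he' hU (hsm a) hyU hyU.1 (e'.map_target hy)
    rwa [e'.right_inv hy] at this
  · intro x hxU V ψ hV hxV hψ hψform
    set Ω := e.target ∩ e.symm ⁻¹' V
    have hΩ : IsOpen Ω := e.isOpen_inter_preimage_symm hV
    have hxΩ : e x ∈ B ∩ Ω :=
      ⟨hxU.2, e.map_source hxU.1, by simpa [e.left_inv hxU.1] using hxV⟩
    obtain ⟨ε, hε, hball⟩ := Metric.isOpen_iff.1 (hB.inter hΩ) _ hxΩ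
    -- F is the solution on all of B with the jet of ψ at x. Uniqueness on a small ball makes it an
    -- extension of the germ of ψ, and its jet at the centre is the required parameter.
    obtain ⟨F, hF, hF0, hF1, hFform⟩ := hsol (e x) hxU.2 ((ψ ∘ e.symm) (e x))
      (fun i => partialDeriv i (ψ ∘ e.symm) (e x))
    have hxb : e x ∈ Metric.ball (e x) ε := Metric.mem_ball_self hε
    have hb1 : Metric.ball (e x) ε ⊆ B := hball.trans inter_subset_left
    have hb2 : Metric.ball (e x) ε ⊆ Ω := hball.trans inter_subset_right
    have e1 : EqOn F (ψ ∘ e.symm) (Metric.ball (e x) ε) :=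
      uniq Metric.isOpen_ball (convex_ball _ _) (hb1.trans hsub) (hF.mono hb1)
        ((contDiffOn_in_chart he hψ).mono hb2) (fun y hy => hFform y (hb1 hy))
        (fun y hy => hψform e he y (hb2 hy).1 (hb2 hy).2) hxb hF0 hF1
    refine ⟨(F (e p), fun i => partialDeriv i F (e p)), ?_, ?_⟩
    · have e2 : EqOn F (f (F (e p), fun i => partialDeriv i F (e p))) B :=
        uniq hB (convex_ball _ _) hsub hF (hfs _) hFform (hform _) hpB
          (hf0 (F (e p), fun i => partialDeriv i F (e p))).symm
          fun i => (hf1 (F (e p), fun i => partialDeriv i F (e p)) i).symm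
      have hev : ∀ᶠ z in 𝓝 x, e z ∈ Metric.ball (e x) ε :=
        (e.continuousAt hxU.1).eventually (Metric.isOpen_ball.mem_nhds hxb)
      filter_upwards [hev, e.open_source.mem_nhds hxU.1] with z hz hze
      rw [Function.comp_apply, ← e2 (hb1 hz), e1 hz, Function.comp_apply, e.left_inv hze]
    · intro a ha
      have h1 : F =ᶠ[𝓝 (e x)] f a := by
        have h2 : ∀ᶠ z in 𝓝 (e x), ψ (e.symm z) = (f a ∘ e) (e.symm z) := by
          have h3 := e.continuousAt_symm (e.map_source hxU.1)
          rw [ContinuousAt, e.left_inv hxU.1] at h3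
          exact h3.eventually ha
        filter_upwards [h2, Metric.isOpen_ball.mem_nhds hxb] with z hz hzb
        rw [e1 hzb, Function.comp_apply, hz, Function.comp_apply,
          e.right_inv (hsub (hb1 hzb))]
      -- If `f a` has the same germ at x, it agrees with F on B, so a is the jet of F at the centre.
      have e2 : EqOn F (f a) B := uniq hB (convex_ball _ _) hsub hF (hfs a) hFform (hform a) hxU.2
        h1.self_of_nhds fun i => partialDeriv_congr h1
      have e3 : F =ᶠ[𝓝 (e p)] f a := by
        filter_upwards [hB.mem_nhds hpB] with z hz using e2 hz
      refine Prod.ext ?_ (funext fun i => ?_)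
      · exact (hf0 a).symm.trans e3.self_of_nhds.symm
      · exact (hf1 a i).symm.trans (partialDeriv_congr e3).symm

theorem isCodazziFamily_iff_local (hc : IsTensorFamily c) (hg : HasSectionalCurvature g κ) :
    IsCodazziFamily g c ↔ ∀ p : M, ∃ U : Set M, IsOpen U ∧ p ∈ U ∧ ∃ φ : M → ℝ,
      ContMDiffOn (𝓡 n) 𝓘(ℝ, ℝ) ∞ φ U ∧ HasFormOn g c κ φ U := by
  refine ⟨fun hcod p => ?_, isCodazziFamily_of_form hc hg⟩
  obtain ⟨U, hU, hpU, φ, hφ, -⟩ := exists_local_family hc hg hcod p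
  -- Any parameter would do.
  exact ⟨U, hU, hpU, φ 0, hφ 0⟩

theorem isCodazziFamily_iff_global [SimplyConnectedSpace M] (hc : IsTensorFamily c)
    (hg : HasSectionalCurvature g κ) :
    IsCodazziFamily g c ↔ ∃ φ : M → ℝ,
      ContMDiff (𝓡 n) 𝓘(ℝ, ℝ) ∞ φ ∧ HasFormOn g c κ φ univ := by
  refine ⟨fun hcod => ?_, fun ⟨φ, hφ, hform⟩ => isCodazziFamily_of_form hc hg fun p =>
    ⟨univ, isOpen_univ, mem_univ p, φ, hφ.contMDiffOn, hform⟩⟩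
  have : LocallyPathConnectedSpace M :=
    ChartedSpace.locallyPathConnectedSpace (EuclideanSpace ℝ (Fin n)) M
  choose U hU hpU φ hφ hgerm using exists_local_family hc hg hcod
  -- Members of one family are solutions, so on an overlap each of their germs belongs to exactly
  -- one member of the other family.
  obtain ⟨Φ, hΦ⟩ := exists_global_of_germs U hU hpU φ fun p q x hx a =>
    hgerm q x hx.2 (U p) (φ p a) (hU p) hx.1 (hφ p a).1 (hφ p a).2
  refine ⟨Φ, fun x => ?_, fun e he y hy _ => ?_⟩
  · obtain ⟨a, ha⟩ := hΦ x
    exact ((hφ x a).1.contMDiffAt ((hU x).mem_nhds (hpU x))).congr_of_eventuallyEq ha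
  · obtain ⟨a, ha⟩ := hΦ (e.symm y)
    exact ((hφ _ a).2 e he y hy (hpU _)).congr hy ha

end Ferus

end CottonGravity

namespace CottonGravity

/-! ### Cotton gravity on spaces of constant curvature -/

section CottonGravityTensor

open Filter Topology

/-! ### Traces, and the Cotton tensor of constant curvature, in coordinates. -/

section Coordinates

variable {n : ℕ} {Ω : Set (EuclideanSpace ℝ (Fin n))}
  {G H B : EuclideanSpace ℝ (Fin n) → Matrix (Fin n) (Fin n) ℝ} {y : EuclideanSpace ℝ (Fin n)}

theorem metricTrace_eq_trace : metricTrace G H y = ((G y)⁻¹ * (H y).transpose).trace := by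
  simp [metricTrace, Matrix.trace, Matrix.mul_apply]

theorem metricTrace_self (hsymm : ∀ z i j, G z i j = G z j i) (hdet : IsUnit (G y).det) :
    metricTrace G G y = n := by
  have : (G y).transpose = G y := by
    ext i j
    exact hsymm y j i
  rw [metricTrace_eq_trace, this, Matrix.nonsing_inv_mul _ hdet, Matrix.trace_one, Fintype.card_fin]

theorem metricTrace_of_eq (hsymm : ∀ z i j, G z i j = G z j i) (hdet : IsUnit (G y).det)
    {a b : ℝ} (h : ∀ k l, H y k l = a * G y k l + b * B y k l) :
    metricTrace G H y = a * n + b * metricTrace G B y := by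
  rw [← metricTrace_self hsymm hdet]
  simp only [metricTrace, h, Finset.mul_sum, ← Finset.sum_add_distrib]
  refine Finset.sum_congr rfl fun i _ => Finset.sum_congr rfl fun j _ => ?_
  ring

/-- With G' = JᵀGJ and H' = JᵀHJ, the Jacobians cancel by cyclicity of the trace. -/
theorem metricTrace_transformed {G' H' : EuclideanSpace ℝ (Fin n) → Matrix (Fin n) (Fin n) ℝ}
    {ψ : EuclideanSpace ℝ (Fin n) → EuclideanSpace ℝ (Fin n)}
    (hG' : ∀ a b, G' y a b
      = ∑ i, ∑ j, jacobian ψ y i a * jacobian ψ y j b * G (ψ y) i j)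
    (hH' : ∀ a b, H' y a b
      = ∑ i, ∑ j, jacobian ψ y i a * jacobian ψ y j b * H (ψ y) i j)
    (hdet : IsUnit (G' y).det) : metricTrace G' H' y = metricTrace G H (ψ y) := by
  have hJ := isUnit_det_jacobian hG' hdet
  set J := jacobian ψ y
  have hmul : ∀ A A' : Matrix (Fin n) (Fin n) ℝ,
      (∀ a b, A' a b = ∑ i, ∑ j, J i a * J j b * A i j) → A' = J.transpose * A * J := by
    intro A A' h
    ext a b
    simp only [h, Matrix.mul_apply, Matrix.transpose_apply, Finset.sum_mul]
    rw [Finset.sum_comm]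
    refine Finset.sum_congr rfl fun i _ => Finset.sum_congr rfl fun j _ => ?_
    ring
  have hJt : IsUnit J.transpose.det := by rwa [Matrix.det_transpose]
  rw [metricTrace_eq_trace, metricTrace_eq_trace, hmul _ _ hG', hmul _ _ hH']
  rw [Matrix.mul_inv_rev, Matrix.mul_inv_rev, Matrix.transpose_mul, Matrix.transpose_mul,
    Matrix.transpose_transpose]
  have : J⁻¹ * ((G (ψ y))⁻¹ * J.transpose⁻¹) * (J.transpose * ((H (ψ y)).transpose * J))
      = J⁻¹ * ((G (ψ y))⁻¹ * (H (ψ y)).transpose * J) := by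
    simp only [Matrix.mul_assoc]
    rw [← Matrix.mul_assoc J.transpose⁻¹, Matrix.nonsing_inv_mul _ hJt, Matrix.one_mul]
  rw [this, Matrix.trace_mul_comm, Matrix.mul_assoc, Matrix.mul_nonsing_inv _ hJ, Matrix.mul_one]

theorem covDeriv_congr (h : ∀ᶠ z in 𝓝 y, H z = B z) (i j k : Fin n) :
    covDeriv G H i j k y = covDeriv G B i j k y := by
  have h1 : ∀ j k, (fun z => H z j k) =ᶠ[𝓝 y] fun z => B z j k := fun j k =>
    h.mono fun z hz => congrFun (congrFun hz j) k
  simp only [covDeriv, partialDeriv_congr (h1 _ _), h.self_of_nhds]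

/-- Since ∇g = 0, only the scalar factor of g is differentiated. It serves for the trace-adjusted
tensor and, with H = 0 and s constant, for the Ricci tensor. -/
theorem covDeriv_smul_metric_sub (hsymm : ∀ z i j, G z i j = G z j i) (hdet : IsUnit (G y).det)
    (dG : ∀ i j, DifferentiableAt ℝ (fun z => G z i j) y)
    (dH : ∀ i j, DifferentiableAt ℝ (fun z => H z i j) y) {s : EuclideanSpace ℝ (Fin n) → ℝ}
    (ds : DifferentiableAt ℝ s y) (i j k : Fin n) :
    covDeriv G (fun z => Matrix.of fun k l => s z * G z k l - H z k l) i j k y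
      = partialDeriv i s y * G y j k - covDeriv G H i j k y := by
  simp only [covDeriv, Matrix.of_apply]
  rw [partialDeriv_sub (ds.fun_mul (dG j k)) (dH j k), partialDeriv_mul ds (dG j k),
    partialDeriv_metric hsymm hdet i j k]
  have : ∑ p, (christoffel G p i j y * (s y * G y p k - H y p k)
        + christoffel G p i k y * (s y * G y j p - H y j p))
      = s y * (∑ p, christoffel G p i j y * G y p k + ∑ p, christoffel G p i k y * G y p j)
        - ∑ p, (christoffel G p i j y * H y p k + christoffel G p i k y * H y j p) := by
    simp only [← Finset.sum_add_distrib, ← Finset.sum_sub_distrib, Finset.mul_sum]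
    refine Finset.sum_congr rfl fun p _ => ?_
    rw [hsymm y j p]
    ring
  rw [this]
  ring

theorem ricci_of_constCurv {κ : ℝ} (hdet : IsUnit (G y).det)
    (hR : ∀ j k l m, riemann G j k l m y = κ * (G y j l * G y k m - G y j m * G y k l))
    (l k : Fin n) : ricci G y l k = κ * ((n : ℝ) - 1) * G y l k := by
  simp only [ricci, Matrix.of_apply, riemannUp_eq_of_constCurv hdet hR, if_true, ← Finset.mul_sum,
    Finset.sum_sub_distrib, Finset.sum_const, Finset.card_univ, Fintype.card_fin, nsmul_eq_mul,
    Finset.sum_ite_eq', Finset.mem_univ]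
  ring

/-- The Cotton tensor of a metric of constant curvature vanishes. -/
theorem cotton_of_constCurv {κ R : ℝ} (hΩ : IsOpen Ω) (hsymm : ∀ z i j, G z i j = G z j i)
    (hG : ∀ i j, ContDiffOn ℝ ∞ (fun y => G y i j) Ω) (hdet : ∀ y ∈ Ω, IsUnit (G y).det)
    (hR : ∀ y ∈ Ω, ∀ j k l m,
      riemann G j k l m y = κ * (G y j l * G y k m - G y j m * G y k l))
    (hscal : ∀ y ∈ Ω, scalarCurv G y = R) (hy : y ∈ Ω) (j k l : Fin n) :
    cotton G j k l y = 0 := by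
  have h1 : ∀ i, partialDeriv i (scalarCurv G) y = 0 := fun i => by
    rw [partialDeriv_congr (f₂ := fun _ => R) (by
      filter_upwards [hΩ.mem_nhds hy] with z hz using hscal z hz), partialDeriv_const]
  have h2 : ∀ i j k, covDeriv G (ricci G) i j k y = 0 := by
    intro i j k
    rw [covDeriv_congr (B := fun z => Matrix.of fun k l =>
        κ * ((n : ℝ) - 1) * G z k l - (0 : Matrix (Fin n) (Fin n) ℝ) k l) (by
      filter_upwards [hΩ.mem_nhds hy] with z hz
      ext a b
      simp [ricci_of_constCurv (hdet z hz) (hR z hz)]),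
      covDeriv_smul_metric_sub (H := fun _ => 0) (s := fun _ => κ * ((n : ℝ) - 1)) hsymm (hdet y hy)
        (fun i j => differentiableAt_of_contDiffOn hΩ (hG i j) hy)
        (fun i j => differentiableAt_const _) (differentiableAt_const _), partialDeriv_const]
    simp [covDeriv, partialDeriv_const]
  simp [cotton, h1, h2]

end Coordinates

/-! ### Reduction of Cotton gravity to Codazzi tensors. -/

variable {n : ℕ} {M : Type*} [TopologicalSpace M] [ChartedSpace (EuclideanSpace ℝ (Fin n)) M]
  [IsManifold (𝓡 n) ∞ M] {g : LorentzMetric n M} {T : SymTensorField n M} {R : ℝ}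

/-- The components of the tensor `(tr T) g / (n-1) - T`. -/
noncomputable def traceAdjusted (g : LorentzMetric n M) (T : SymTensorField n M)
    (e : OpenPartialHomeomorph M (EuclideanSpace ℝ (Fin n))) (y : EuclideanSpace ℝ (Fin n)) :
    Matrix (Fin n) (Fin n) ℝ :=
  Matrix.of fun k l =>
    metricTrace (g.comp e) (T.comp e) y / ((n : ℝ) - 1) * g.comp e y k l - T.comp e y k l

theorem contDiffOn_metricTrace (g : LorentzMetric n M) (T : SymTensorField n M)
    {e : OpenPartialHomeomorph M (EuclideanSpace ℝ (Fin n))}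
    (he : e ∈ atlas (EuclideanSpace ℝ (Fin n)) M) :
    ContDiffOn ℝ ∞ (metricTrace (g.comp e) (T.comp e)) e.target :=
  ContDiffOn.sum fun i _ => ContDiffOn.sum fun j _ =>
    (contDiffOn_matrix_inv (contDiffOn_comp _ he) (fun _ hy => isUnit_det_comp g he hy) i j).mul
      (contDiffOn_comp T he i j)

theorem isTensorFamily_traceAdjusted (g : LorentzMetric n M) (T : SymTensorField n M) :
    IsTensorFamily (traceAdjusted g T) where
  smooth e he i j := (((contDiffOn_metricTrace g T he).div_const _).mul
    (contDiffOn_comp _ he i j)).sub (contDiffOn_comp T he i j)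
  symm e y i j := by
    simp only [traceAdjusted, Matrix.of_apply, comp_symm _ y i j]
  transition e he e' he' y hy hy' a b := by
    have hG := comp_transition g.toSymTensorField he he' hy hy'
    have hT := comp_transition T he he' hy hy'
    have htr := metricTrace_transformed (G := g.comp e) (H := T.comp e) hG hT
      (isUnit_det_comp g he' hy)
    simp only [traceAdjusted, Matrix.of_apply, htr]
    rw [hG, hT]
    simp only [Finset.mul_sum, ← Finset.sum_sub_distrib]
    refine Finset.sum_congr rfl fun i _ => Finset.sum_congr rfl fun j _ => ?_
    ring

theorem HasConstantCurvature.hasSectionalCurvature (hg : HasConstantCurvature g R) :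
    HasSectionalCurvature g (R / ((n : ℝ) * ((n : ℝ) - 1))) :=
  fun e he y hy => (hg e he y hy).2

/-- The Cotton gravity equation for `T` is the Codazzi equation for `(tr T) g / (n-1) - T`. -/
theorem solvesCottonGravity_iff (hg : HasConstantCurvature g R) :
    SolvesCottonGravity g T ↔ IsCodazziFamily g (traceAdjusted g T) := by
  refine forall₄_congr fun e he y hy => forall₃_congr fun j k l => ?_
  have hdet : ∀ y ∈ e.target, IsUnit (g.comp e y).det := fun y hy => isUnit_det_comp g he hy
  have hG := contDiffOn_comp g.toSymTensorField he
  have hT := contDiffOn_comp T he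
  have dt := differentiableAt_of_contDiffOn e.open_target (contDiffOn_metricTrace g T he) hy
  rw [cotton_of_constCurv e.open_target (comp_symm _) hG hdet
    (hg.hasSectionalCurvature e he) (fun y hy => (hg e he y hy).1) hy]
  have hcov : ∀ i j k, covDeriv (g.comp e) (traceAdjusted g T e) i j k y
      = partialDeriv i (metricTrace (g.comp e) (T.comp e)) y / ((n : ℝ) - 1) * g.comp e y j k
        - covDeriv (g.comp e) (T.comp e) i j k y := by
    intro i j k
    have h1 := covDeriv_smul_metric_sub
      (s := fun z => metricTrace (g.comp e) (T.comp e) z * ((n : ℝ) - 1)⁻¹) (comp_symm _) (hdet y hy)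
      (fun i j => differentiableAt_of_contDiffOn e.open_target (hG i j) hy)
      (fun i j => differentiableAt_of_contDiffOn e.open_target (hT i j) hy)
      (dt.mul_const _) i j k
    rw [partialDeriv_mul dt (differentiableAt_const _), partialDeriv_const, mul_zero, zero_add] at h1
    exact h1
  rw [hcov, hcov, cottonSource]
  constructor
  · intro h
    linear_combination h
  · intro h
    linear_combination h

theorem hessian_sub_const {G : EuclideanSpace ℝ (Fin n) → Matrix (Fin n) (Fin n) ℝ}
    (f : EuclideanSpace ℝ (Fin n) → ℝ) (a : ℝ) (y : EuclideanSpace ℝ (Fin n)) :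
    hessian G (fun z => f z - a) y = hessian G f y := by
  have : ∀ i, partialDeriv i (fun z => f z - a) = partialDeriv i f := fun i => funext fun z => by
    simp only [partialDeriv, fderiv_sub_const]
  simp only [hessian, this]

/-- With f = φ - (n-2)/2, the bracket multiplying g in the stated form of T is □f + Rf/n. The trace
of (tr T) g/(n-1) - T is tr T/(n-1), so taking traces in either equation expresses tr T through f,
and substituting it back gives the other equation. -/
theorem hasEnergyMomentumFormOn_iff (hn : 2 ≤ n) {φ : M → ℝ} {U : Set M} :
    HasEnergyMomentumFormOn g R T φ U ↔ HasFormOn g (traceAdjusted g T)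
      (R / ((n : ℝ) * ((n : ℝ) - 1))) (fun x => φ x - ((n : ℝ) - 2) / 2) U := by
  have hn2 : (2 : ℝ) ≤ n := by exact_mod_cast hn
  have hn0 : (n : ℝ) ≠ 0 := by linarith
  have hn1 : (n : ℝ) - 1 ≠ 0 := by linarith
  refine forall₄_congr fun e he y hy => forall_congr' fun _ => ?_
  have hdet := isUnit_det_comp g he hy
  have hhess : hessian (g.comp e) ((fun x => φ x - ((n : ℝ) - 2) / 2) ∘ e.symm) y
      = hessian (g.comp e) (φ ∘ e.symm) y := hessian_sub_const (φ ∘ e.symm) _ y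
  simp only [HasFormAt, hhess, Function.comp_apply]
  simp only [traceAdjusted, Matrix.of_apply, dAlembertian]
  set s := metricTrace (g.comp e) (hessian (g.comp e) (φ ∘ e.symm)) y
  set t := metricTrace (g.comp e) (T.comp e) y
  constructor
  · intro h k l
    have ht : t = (s + R * φ (e.symm y) / n - ((n : ℝ) - 2) * R / (2 * n)) * n + -1 * s :=
      metricTrace_of_eq (comp_symm _) hdet fun k l => by rw [h k l]; ring
    rw [ht, h k l]
    field_simp
    ring
  · intro h k l
    have ht : t = (t / ((n : ℝ) - 1) - R / ((n : ℝ) * ((n : ℝ) - 1))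
        * (φ (e.symm y) - ((n : ℝ) - 2) / 2)) * n + -1 * s :=
      metricTrace_of_eq (comp_symm _) hdet fun k l => by linear_combination -h k l
    -- This solves the traced equation for t, which occurs on both sides of `ht`.
    have ht' : t / ((n : ℝ) - 1) = s + R / ((n : ℝ) - 1) * (φ (e.symm y) - ((n : ℝ) - 2) / 2) := by
      field_simp at ht ⊢
      linarith
    have := h k l
    rw [ht'] at this
    have h3 : T.comp e y k l = (s + R / ((n : ℝ) - 1) * (φ (e.symm y) - ((n : ℝ) - 2) / 2)
        - R / ((n : ℝ) * ((n : ℝ) - 1)) * (φ (e.symm y) - ((n : ℝ) - 2) / 2)) * g.comp e y k l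
        - hessian (g.comp e) (φ ∘ e.symm) y k l := by linear_combination -this
    rw [h3]
    field_simp
    ring

theorem hasFerusFormOn_iff {C : SymTensorField n M} {φ : M → ℝ} {U : Set M} :
    HasFerusFormOn g R C φ U ↔ HasFormOn g C.comp (R / ((n : ℝ) * ((n : ℝ) - 1))) φ U := by
  refine forall₄_congr fun e _ y _ => forall₃_congr fun _ j k => ?_
  rw [Function.comp_apply, mul_div_right_comm]

end CottonGravityTensor

end CottonGravity

theorem mainTheorem8 {n : ℕ} (hn : 2 ≤ n) {M : Type*} [TopologicalSpace M] [T2Space M]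
    [SecondCountableTopology M] [ChartedSpace (EuclideanSpace ℝ (Fin n)) M]
    [IsManifold (𝓡 n) ∞ M]
    (g : CottonGravity.LorentzMetric n M) (R : ℝ) (hg : CottonGravity.HasConstantCurvature g R) :
    (∀ C : CottonGravity.SymTensorField n M,
      (CottonGravity.IsCodazzi g C ↔
        ∀ p : M, ∃ U : Set M, IsOpen U ∧ p ∈ U ∧ ∃ φ : M → ℝ,
          ContMDiffOn (𝓡 n) 𝓘(ℝ, ℝ) ∞ φ U ∧ CottonGravity.HasFerusFormOn g R C φ U) ∧
      (SimplyConnectedSpace M →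
        (CottonGravity.IsCodazzi g C ↔
          ∃ φ : M → ℝ, ContMDiff (𝓡 n) 𝓘(ℝ, ℝ) ∞ φ ∧
            CottonGravity.HasFerusFormOn g R C φ Set.univ))) ∧
    (∀ T : CottonGravity.SymTensorField n M,
      (CottonGravity.SolvesCottonGravity g T ↔
        ∀ p : M, ∃ U : Set M, IsOpen U ∧ p ∈ U ∧ ∃ φ : M → ℝ,
          ContMDiffOn (𝓡 n) 𝓘(ℝ, ℝ) ∞ φ U ∧ CottonGravity.HasEnergyMomentumFormOn g R T φ U) ∧
      (SimplyConnectedSpace M →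
        (CottonGravity.SolvesCottonGravity g T ↔
          ∃ φ : M → ℝ, ContMDiff (𝓡 n) 𝓘(ℝ, ℝ) ∞ φ ∧
            CottonGravity.HasEnergyMomentumFormOn g R T φ Set.univ))) := by
  have hκ := hg.hasSectionalCurvature
  refine ⟨fun C => ⟨?_, fun _ => ?_⟩, fun T => ⟨?_, fun _ => ?_⟩⟩
  · simp only [CottonGravity.hasFerusFormOn_iff]
    exact CottonGravity.isCodazziFamily_iff_local C.isTensorFamily hκ
  · simp only [CottonGravity.hasFerusFormOn_iff]
    exact CottonGravity.isCodazziFamily_iff_global C.isTensorFamily hκ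
  · rw [CottonGravity.solvesCottonGravity_iff hg, CottonGravity.isCodazziFamily_iff_local
      (CottonGravity.isTensorFamily_traceAdjusted g T) hκ]
    simp only [CottonGravity.hasEnergyMomentumFormOn_iff hn]
    -- The potential of the Codazzi tensor and that of T differ by the constant (n-2)/2, so
    -- smoothness is unaffected in either direction.
    refine forall_congr' fun p => exists_congr fun U => and_congr_right fun _ =>
      and_congr_right fun _ => ⟨fun ⟨φ, hφ, h⟩ => ⟨fun x => φ x + ((n : ℝ) - 2) / 2, ?_, ?_⟩,
        fun ⟨φ, hφ, h⟩ => ⟨fun x => φ x - ((n : ℝ) - 2) / 2, ?_, h⟩⟩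
    · exact hφ.add contMDiffOn_const
    · simpa using h
    · exact hφ.sub contMDiffOn_const
  · rw [CottonGravity.solvesCottonGravity_iff hg, CottonGravity.isCodazziFamily_iff_global
      (CottonGravity.isTensorFamily_traceAdjusted g T) hκ]
    simp only [CottonGravity.hasEnergyMomentumFormOn_iff hn]
    refine ⟨fun ⟨φ, hφ, h⟩ => ⟨fun x => φ x + ((n : ℝ) - 2) / 2, ?_, ?_⟩,
        fun ⟨φ, hφ, h⟩ => ⟨fun x => φ x - ((n : ℝ) - 2) / 2, ?_, h⟩⟩
    · exact hφ.add contMDiff_const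
    · simpa using h
    · exact hφ.sub contMDiff_const
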